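/- Let $m\ge 1$, let $\xi,\eta\in\mathbb{R}_{\ge 0}^m$ be column vectors and let $A,B\in\mathbb{R}_{\ge 0}^{m\times m}$. Let $\mu$ be the monoid morphism from the free monoid $\{a,b\}^*$ to $\mathbb{R}_{\ge 0}^{m\times m}$ with $\mu(a)=A$, $\mu(b)=B$, and for a word $w$ put $(r,w)=\xi'\mu(w)\eta$. Assume that for every $n\ge 1$ there is a word $w$ of length $n$ with $(r,w)>0$. For $n\ge1$ let $\{a,b\}^n$ carry the probability $$\Pr(w)=\frac{(r,w)}{\sum_{x\in\{a,b\}^n}(r,x)},$$ and let $Y_n$ be the number of occurrences of $a$ in a word of length $n$ drawn with this probability. Assume that $A\neq 0\neq B$, that $M=A+B$ is primitive (some power of $M$ has only positive entries), and that $(A,B)$ is aperiodic in the following sense. Consider the labelled directed graph on $\{1,\dots,m\}$ with an edge $i\to j$ labelled $a$ whenever $A_{ij}>0$ and an edge $i\to j$ labelled $b$ whenever $B_{ij}>0$. The greatest common divisor of all differences $|\ell(C_1)|_a-|\ell(C_2)|_a$ is $1$, where $C_1,C_2$ range over the pairs of cycles (closed walks) of equal length, $\ell(C)$ is the word that labels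 $C$, and $|w|_a$ is the number of occurrences of $a$ in $w$. Then $M$ has an eigenvalue $\lambda>0$ that is greater than the modulus of every other (complex) eigenvalue of $M$, and there is a function $u$, analytic in a neighbourhood of $0\in\mathbb{C}$, such that $\det(I\,u(z)-Ae^z-B)=0$ for all $z$ near $0$ and $u(0)=\lambda$. For every such $\lambda$ and $u$ the numbers $$\beta=\frac{u'(0)}{\lambda},\qquad \gamma=\frac{u''(0)}{\lambda}-\left(\frac{u'(0)}{\lambda}\right)^2$$ are real and strictly positive, and, as $n\to+\infty$, $$\left|\sqrt n\,\Pr(Y_n=k)-\frac{1}{\sqrt{2\pi\gamma}}\,e^{-\frac{(k-\beta n)^2}{2\gamma n}}\right|=O\!\left(n^{-1/2}\right)$$ uniformly for $k\in\{0,1,\dots,n\}$; that is, there are $C$ and $N$ such that for all $n\ge N$ and all $k\in\{0,\dots,n\}$ the left-hand side is at most $C n^{-1/2}$. -/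

import Mathlib

open scoped Matrix Topology

noncomputable section

/-- The binary alphabet `{a, b}`. -/
inductive Letter where
  | a : Letter
  | b : Letter
  deriving DecidableEq

instance : Fintype Letter where
  elems := {Letter.a, Letter.b}
  complete := by intro x; cases x <;> decide

/-- A linear representation `(ξ, A, B, η)` of size `m`, with non-negative real entries. -/
structure LinearRep (m : ℕ) where
  ξ : Fin m → ℝ
  A : Matrix (Fin m) (Fin m) ℝ
  B : Matrix (Fin m) (Fin m) ℝ
  η : Fin m → ℝ
  ξ_nonneg : ∀ i, 0 ≤ ξ i
  A_nonneg : ∀ i j, 0 ≤ A i j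
  B_nonneg : ∀ i j, 0 ≤ B i j
  η_nonneg : ∀ i, 0 ≤ η i

namespace LinearRep

variable {m : ℕ}

/-- The matrix attached to a letter: `A` for `a`, `B` for `b`. -/
def letterMatrix (R : LinearRep m) : Letter → Matrix (Fin m) (Fin m) ℝ
  | Letter.a => R.A
  | Letter.b => R.B

/-- The monoid morphism `μ : {a, b}* → ℝ₊^{m × m}` with `μ(a) = A` and `μ(b) = B`. -/
def μ (R : LinearRep m) : FreeMonoid Letter →* Matrix (Fin m) (Fin m) ℝ :=
  FreeMonoid.lift R.letterMatrix

/-- The rational series `(r, w) = ξ' μ(w) η`. -/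
def series (R : LinearRep m) (w : FreeMonoid Letter) : ℝ :=
  R.ξ ⬝ᵥ (R.μ w *ᵥ R.η)

/-- The value of the series at a word of length `n`. -/
def weight (R : LinearRep m) {n : ℕ} (w : List.Vector Letter n) : ℝ :=
  R.series (FreeMonoid.ofList w.toList)

/-- For every `n ≥ 1` some word of length `n` has positive weight, so that the probability
on words of length `n` is defined. -/
def HasPositiveWords (R : LinearRep m) : Prop :=
  ∀ n : ℕ, 1 ≤ n → ∃ w : List.Vector Letter n, 0 < R.weight w

/-- `Pr(w) = (r, w) / ∑_{|x| = n} (r, x)` for a word `w` of length `n`. -/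
def wordProb (R : LinearRep m) {n : ℕ} (w : List.Vector Letter n) : ℝ :=
  R.weight w / ∑ x : List.Vector Letter n, R.weight x

theorem letterMatrix_nonneg (R : LinearRep m) (x : Letter) (i j : Fin m) :
    0 ≤ R.letterMatrix x i j := by
  cases x
  · exact R.A_nonneg i j
  · exact R.B_nonneg i j

theorem μ_nonneg (R : LinearRep m) (w : FreeMonoid Letter) (i j : Fin m) : 0 ≤ R.μ w i j := by
  induction w using FreeMonoid.inductionOn' generalizing i j with
  | one => simp only [map_one, Matrix.one_apply]; split_ifs <;> norm_num
  | of_mul x w ih =>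
    rw [map_mul, Matrix.mul_apply]
    refine Finset.sum_nonneg fun k _ => mul_nonneg ?_ (ih k j)
    simpa [μ] using R.letterMatrix_nonneg x i k

theorem weight_nonneg (R : LinearRep m) {n : ℕ} (w : List.Vector Letter n) : 0 ≤ R.weight w := by
  simp only [weight, series, Matrix.mulVec, dotProduct]
  exact Finset.sum_nonneg fun i _ => mul_nonneg (R.ξ_nonneg i)
    (Finset.sum_nonneg fun j _ => mul_nonneg (R.μ_nonneg _ i j) (R.η_nonneg j))

theorem wordProb_nonneg (R : LinearRep m) {n : ℕ} (w : List.Vector Letter n) :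
    0 ≤ R.wordProb w :=
  div_nonneg (R.weight_nonneg w) (Finset.sum_nonneg fun x _ => R.weight_nonneg x)

/-- For `n ≥ 1`, `wordProb` is a probability on the words of length `n`. -/
theorem sum_wordProb (R : LinearRep m) (hR : R.HasPositiveWords) {n : ℕ} (hn : 1 ≤ n) :
    ∑ w : List.Vector Letter n, R.wordProb w = 1 := by
  obtain ⟨w, hw⟩ := hR n hn
  have h : 0 < ∑ x : List.Vector Letter n, R.weight x :=
    Finset.sum_pos' (fun x _ => R.weight_nonneg x) ⟨w, Finset.mem_univ w, hw⟩
  simp only [wordProb]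
  rw [← Finset.sum_div, div_self h.ne']

/-- The symbol statistic `Y_n`: the number of occurrences of `a` in a word of length `n`. -/
def Y (n : ℕ) (w : List.Vector Letter n) : ℕ := w.toList.count Letter.a

/-- `Pr(Y_n = k)`, where the word is drawn according to `wordProb`. -/
def probY (R : LinearRep m) (n k : ℕ) : ℝ :=
  ∑ w : List.Vector Letter n with Y n w = k, R.wordProb w

/-- The transition graph has an edge from `i` to `j` labelled `x`. -/
def Edge (R : LinearRep m) (x : Letter) (i j : Fin m) : Prop :=
  0 < R.letterMatrix x i j

/-- In the transition graph there is a walk from `i` to `j` whose label is the given word. -/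
def Walk (R : LinearRep m) : Fin m → List Letter → Fin m → Prop
  | i, [], j => i = j
  | i, x :: w, j => ∃ k, R.Edge x i k ∧ Walk R k w j

/-- `w` is the label of a cycle, i.e. of a closed walk with at least one edge. -/
def IsCycleLabel (R : LinearRep m) (w : List Letter) : Prop :=
  w ≠ [] ∧ ∃ i, R.Walk i w i

/-- All differences `|ℓ(C₁)|_a - |ℓ(C₂)|_a`, for cycles `C₁`, `C₂` of equal length. -/
def cycleDiffs (R : LinearRep m) : Set ℤ :=
  {x | ∃ w₁ w₂ : List Letter, R.IsCycleLabel w₁ ∧ R.IsCycleLabel w₂ ∧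
    w₁.length = w₂.length ∧ x = (w₁.count Letter.a : ℤ) - (w₂.count Letter.a : ℤ)}

end LinearRep

/-- `d ≥ 0` is the greatest common divisor of the set `S` of integers
(with value `0` when `S ⊆ {0}`). -/
def IsSetGCD (d : ℕ) (S : Set ℤ) : Prop :=
  (∀ x ∈ S, (d : ℤ) ∣ x) ∧ ∀ e : ℕ, (∀ x ∈ S, (e : ℤ) ∣ x) → e ∣ d

/-- The pair `(A, B)` is aperiodic: the GCD of the cycle differences is `1`. -/
def LinearRep.IsAperiodic {m : ℕ} (R : LinearRep m) : Prop :=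
  IsSetGCD 1 R.cycleDiffs

/-- `l` is a positive eigenvalue of `M` that is greater than the modulus of every other complex
eigenvalue of `M`. -/
def IsPerronEigenvalue {m : ℕ} (M : Matrix (Fin m) (Fin m) ℝ) (l : ℝ) : Prop :=
  0 < l ∧
  Module.End.HasEigenvalue (Matrix.toLin' (M.map Complex.ofReal)) (l : ℂ) ∧
  ∀ c : ℂ, Module.End.HasEigenvalue (Matrix.toLin' (M.map Complex.ofReal)) c →
    c ≠ (l : ℂ) → ‖c‖ < l

/-- `u` is an analytic solution, near `z = 0`, of `det(I u(z) - A e^z - B) = 0` with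
`u(0) = l`. -/
def IsEigenvalueBranch {m : ℕ} (A B : Matrix (Fin m) (Fin m) ℝ) (l : ℝ) (u : ℂ → ℂ) : Prop :=
  AnalyticAt ℂ u 0 ∧ u 0 = (l : ℂ) ∧
  ∀ᶠ z in 𝓝 (0 : ℂ),
    (u z • (1 : Matrix (Fin m) (Fin m) ℂ) - Complex.exp z • A.map Complex.ofReal
      - B.map Complex.ofReal).det = 0

/-- `β = u'(0) / l`. -/
def betaOf (l : ℝ) (u : ℂ → ℂ) : ℂ := deriv u 0 / l

/-- `γ = u''(0) / l - (u'(0) / l)²`. -/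
def gammaOf (l : ℝ) (u : ℂ → ℂ) : ℂ := iteratedDeriv 2 u 0 / l - (deriv u 0 / l) ^ 2

end

/-! By Perron–Frobenius, M = A + B has positive eigenvectors Mv = λv and w'M = λw'. Conjugating by
diag(v) and dividing by λ (`LinearRep.rescale`) leaves every Pr(Y_n = k) unchanged, makes A + B
stochastic with stationary distribution p_i = w_i v_i, and divides u by λ. So λ = 1 may be assumed.

The unnormalised characteristic function of Y_n is ξ'(A e^{iθ} + B)^n η. It is compared on [-π, π]
with c·exp(n(iβθ - γθ²/2)), where c = (ξ'1)(p'η). Near θ = 0 the spectral projection of the dominant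
eigenvalue is analytic, so the function is u^n r up to an exponentially small term (`quasi_power`),
and the Taylor expansion of log u makes it Gaussian up to O(|θ| e^{-γnθ²/8})
(`exists_quasi_power_bound`). Away from 0, aperiodicity gives two closed walks of equal length with
different phases; inserted into paths with common ends they cause cancellation, so a power of the
matrix is a strict contraction, uniformly by compactness (`uniformPowDecay_expTwist`). Integrating
these errors and inverting the Fourier transform gives Pr(Y_n = k) up to O(1/n), and the factor √n
turns this into O(n^{-1/2}).

The variance γ is a stationary average of squares (`variance_eq_sum_sq`). It vanishes only if the
edge labels derive from a potential; then cycles of equal length would contain equally many a's,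
against aperiodicity. -/

namespace Matrix

/-! ### Perron–Frobenius eigenvectors of primitive matrices. -/

variable {ι : Type*} [Fintype ι]

theorem mulVec_pos_of_pos {M : Matrix ι ι ℝ} (hM : ∀ i j, 0 < M i j) {x : ι → ℝ}
    (hx : ∀ i, 0 ≤ x i) (hx0 : x ≠ 0) (i : ι) : 0 < (M *ᵥ x) i := by
  obtain ⟨j, hj⟩ := Function.ne_iff.mp hx0
  exact Finset.sum_pos' (fun j _ => mul_nonneg (hM i j).le (hx j))
    ⟨j, Finset.mem_univ j, mul_pos (hM i j) (lt_of_le_of_ne (hx j) (Ne.symm hj))⟩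

theorem le_sum_entries_of_subinvariant {M : Matrix ι ι ℝ} (hM : ∀ i j, 0 ≤ M i j) {x : ι → ℝ}
    (hx : x ∈ stdSimplex ℝ ι) {t : ℝ} (ht : ∀ i, t * x i ≤ (M *ᵥ x) i) :
    t ≤ ∑ i, ∑ j, M i j := by
  have h1 : t = ∑ i, t * x i := by rw [← Finset.mul_sum, hx.2, mul_one]
  rw [h1]
  refine Finset.sum_le_sum fun i _ => (ht i).trans (Finset.sum_le_sum fun j _ => ?_)
  exact mul_le_of_le_one_right (hM i j) (hx.2 ▸ Finset.single_le_sum (fun j _ => hx.1 j)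
    (Finset.mem_univ j))

variable [DecidableEq ι]

theorem IsPrimitive.transpose {M : Matrix ι ι ℝ} (hM : M.IsPrimitive) : Mᵀ.IsPrimitive := by
  obtain ⟨h0, k, hk, hpos⟩ := hM
  refine ⟨fun i j => h0 j i, k, hk, fun i j => ?_⟩
  rw [← transpose_pow]
  exact hpos j i

/-- A primitive matrix has a positive eigenvalue with an entrywise positive eigenvector. -/
theorem IsPrimitive.exists_pos_eigenvector [Nonempty ι] {M : Matrix ι ι ℝ} (hM : M.IsPrimitive) :
    ∃ l : ℝ, 0 < l ∧ ∃ v : ι → ℝ, (∀ i, 0 < v i) ∧ M *ᵥ v = l • v := by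
  obtain ⟨h0, k, hk, hpos⟩ := hM
  -- Collatz–Wielandt: the eigenvalue is the largest t with t x ≤ M x for some x in the simplex. The
  -- upper bound on t costs nothing, by `le_sum_entries_of_subinvariant`, and makes the set compact.
  set S : Set (ℝ × (ι → ℝ)) :=
    (Set.Icc 0 (∑ i, ∑ j, M i j) ×ˢ stdSimplex ℝ ι) ∩ {p | ∀ i, p.1 * p.2 i ≤ (M *ᵥ p.2) i}
    with hS
  have hScomp : IsCompact S := by
    refine (isCompact_Icc.prod (isCompact_stdSimplex ℝ ι)).inter_right ?_
    rw [Set.ofPred_forall]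
    refine isClosed_iInter fun i => isClosed_le (by fun_prop) ?_
    simp only [mulVec, dotProduct]
    fun_prop
  have hSne : S.Nonempty := by
    obtain ⟨i⟩ := ‹Nonempty ι›
    refine ⟨(0, Pi.single i 1), ⟨⟨le_rfl, ?_⟩, single_mem_stdSimplex ℝ i⟩, fun j => ?_⟩
    · exact Finset.sum_nonneg fun i _ => Finset.sum_nonneg fun j _ => h0 i j
    · simpa using h0 j i
  obtain ⟨⟨l, x⟩, ⟨⟨⟨hl0, -⟩, hx⟩, hlx⟩, hmax⟩ :=
    hScomp.exists_isMaxOn hSne continuous_fst.continuousOn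
  simp only at hl0 hx hlx
  have hxne : x ≠ 0 := by
    rintro rfl
    simpa using hx.2
  have hMx : M *ᵥ x = l • x := by
    -- If the slack M x - l x is non-zero, M ^ k makes it strictly positive, so y = M ^ k x,
    -- normalised, admits a factor larger than l.
    by_contra hne
    have hd : ∀ i, 0 < ((M ^ k) *ᵥ (M *ᵥ x - l • x)) i :=
      mulVec_pos_of_pos hpos (fun i => by simpa using hlx i) (sub_ne_zero.mpr hne)
    have hy : ∀ i, 0 < ((M ^ k) *ᵥ x) i := mulVec_pos_of_pos hpos hx.1 hxne
    set y := (M ^ k) *ᵥ x with hydef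
    have hMy : (M ^ k) *ᵥ (M *ᵥ x - l • x) = M *ᵥ y - l • y := by
      rw [mulVec_sub, mulVec_smul, hydef, mulVec_mulVec, mulVec_mulVec, ← pow_succ, ← pow_succ']
    rw [hMy] at hd
    set s := ∑ i, y i with hs
    have hspos : 0 < s := Finset.sum_pos (fun i _ => hy i) Finset.univ_nonempty
    have hys : ∀ i, y i ≤ s := fun i =>
      Finset.single_le_sum (fun j _ => (hy j).le) (Finset.mem_univ i)
    obtain ⟨i₀, -, hi₀⟩ := Finset.exists_min_image Finset.univ
      (fun i => (M *ᵥ y - l • y) i) Finset.univ_nonempty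
    -- Least slack over the coordinate sum: since y i ≤ s, adding ε to l costs at most the slack
    -- available in each row.
    set ε := (M *ᵥ y - l • y) i₀ / s
    have hε : 0 < ε := div_pos (hd i₀) hspos
    have hy' : s⁻¹ • y ∈ stdSimplex ℝ ι := by
      refine ⟨fun i => mul_nonneg (inv_nonneg.mpr hspos.le) (hy i).le, ?_⟩
      simp only [Pi.smul_apply, smul_eq_mul, ← Finset.mul_sum]
      exact inv_mul_cancel₀ hspos.ne'
    have hle : ∀ i, (l + ε) * (s⁻¹ • y) i ≤ (M *ᵥ (s⁻¹ • y)) i := by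
      intro i
      have h1 : ε * y i ≤ (M *ᵥ y) i - l * y i := by
        calc ε * y i ≤ ε * s := by gcongr; exact hys i
          _ = (M *ᵥ y - l • y) i₀ := div_mul_cancel₀ _ hspos.ne'
          _ ≤ _ := by simpa using hi₀ i (Finset.mem_univ i)
      rw [mulVec_smul]
      simp only [Pi.smul_apply, smul_eq_mul]
      have : (l + ε) * y i ≤ (M *ᵥ y) i := by linarith
      calc (l + ε) * (s⁻¹ * y i) = s⁻¹ * ((l + ε) * y i) := by ring
        _ ≤ _ := by gcongr
    have hmem : ((l + ε, s⁻¹ • y) : ℝ × (ι → ℝ)) ∈ S :=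
      ⟨⟨⟨by positivity, le_sum_entries_of_subinvariant h0 hy' hle⟩, hy'⟩, hle⟩
    have := hmax hmem
    simp only [Set.mem_ofPred_eq] at this
    linarith
  have hpow : ∀ n : ℕ, (M ^ n) *ᵥ x = l ^ n • x := by
    intro n
    induction n with
    | zero => simp
    | succ n ih => rw [pow_succ, ← mulVec_mulVec, hMx, mulVec_smul, ih, smul_smul, pow_succ']
  have hlx' : ∀ i, 0 < l ^ k * x i := fun i => by
    have := mulVec_pos_of_pos hpos hx.1 hxne i
    rwa [hpow] at this
  refine ⟨l, lt_of_le_of_ne hl0 ?_, x, fun i => lt_of_le_of_ne (hx.1 i) ?_, hMx⟩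
  · rintro rfl
    obtain ⟨i⟩ := ‹Nonempty ι›
    simpa [hk.ne'] using hlx' i
  · intro h
    simpa [← h] using hlx' i

/-- Left and right Perron eigenvectors of a primitive matrix, normalised to have product `1`. -/
theorem IsPrimitive.exists_perron_pair [Nonempty ι] {M : Matrix ι ι ℝ} (hM : M.IsPrimitive) :
    ∃ l : ℝ, 0 < l ∧ ∃ v w : ι → ℝ, (∀ i, 0 < v i) ∧ (∀ i, 0 < w i) ∧ M *ᵥ v = l • v ∧
      w ᵥ* M = l • w ∧ w ⬝ᵥ v = 1 := by
  obtain ⟨l, hl, v, hv, hMv⟩ := hM.exists_pos_eigenvector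
  obtain ⟨l', hl', w, hw, hMw⟩ := hM.transpose.exists_pos_eigenvector
  rw [mulVec_transpose] at hMw
  have hwv : 0 < w ⬝ᵥ v := Finset.sum_pos (fun i _ => mul_pos (hw i) (hv i)) Finset.univ_nonempty
  -- Evaluating w'Mv from both sides identifies the two eigenvalues.
  have hll : l' = l := by
    have h := dotProduct_mulVec w M v
    rw [hMv, hMw, dotProduct_smul, smul_dotProduct, smul_eq_mul, smul_eq_mul] at h
    exact (mul_right_cancel₀ hwv.ne' h).symm
  subst hll
  refine ⟨l', hl, v, (w ⬝ᵥ v)⁻¹ • w, hv, fun i => mul_pos (inv_pos.mpr hwv) (hw i), hMv, ?_, ?_⟩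
  · rw [smul_vecMul, hMw, smul_comm]
  · rw [smul_dotProduct, smul_eq_mul, inv_mul_cancel₀ hwv.ne']

end Matrix

/-! ### Operator norms, uniform decay of powers, contraction of stochastic matrices. -/

namespace Matrix

open scoped Matrix.Norms.Operator
open Filter

section Norm

variable {ι : Type*} [Fintype ι]

theorem linfty_opNorm_le_of_forall_sum_le {α : Type*} [SeminormedAddCommGroup α]
    {M : Matrix ι ι α} {r : ℝ} (hr : 0 ≤ r) (h : ∀ i, ∑ j, ‖M i j‖ ≤ r) : ‖M‖ ≤ r := by
  lift r to NNReal using hr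
  rw [linfty_opNorm_def, NNReal.coe_le_coe]
  refine Finset.sup_le fun i _ => ?_
  rw [← NNReal.coe_le_coe]
  simpa using h i

theorem linfty_opNorm_lt_of_forall_sum_lt {α : Type*} [SeminormedAddCommGroup α]
    {M : Matrix ι ι α} {r : ℝ} (hr : 0 < r) (h : ∀ i, ∑ j, ‖M i j‖ < r) : ‖M‖ < r := by
  lift r to NNReal using hr.le
  rw [linfty_opNorm_def, NNReal.coe_lt_coe]
  refine (Finset.sup_lt_iff (by simpa using hr)).mpr fun i _ => ?_
  rw [← NNReal.coe_lt_coe]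
  simpa using h i

theorem linfty_opNorm_map_ofReal (M : Matrix ι ι ℝ) : ‖M.map Complex.ofReal‖ = ‖M‖ := by
  simp [linfty_opNorm_def]

theorem norm_apply_le_linfty_opNorm {α : Type*} [SeminormedAddCommGroup α]
    (M : Matrix ι ι α) (i j : ι) : ‖M i j‖ ≤ ‖M‖ := by
  rw [linfty_opNorm_def, ← coe_nnnorm, NNReal.coe_le_coe]
  exact (Finset.single_le_sum (f := fun j => ‖M i j‖₊) (fun _ _ => zero_le)
    (Finset.mem_univ j)).trans (Finset.le_sup (f := fun i => ∑ j, ‖M i j‖₊) (Finset.mem_univ i))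

theorem norm_dotProduct_mulVec_le (M : Matrix ι ι ℂ) (x y : ι → ℂ) :
    ‖x ⬝ᵥ (M *ᵥ y)‖ ≤ (∑ i, ‖x i‖) * (∑ j, ‖y j‖) * ‖M‖ := by
  calc ‖x ⬝ᵥ (M *ᵥ y)‖ ≤ ∑ i, ‖x i‖ * ∑ j, ‖M‖ * ‖y j‖ := by
        simp only [dotProduct, mulVec]
        refine norm_sum_le_of_le _ fun i _ => ?_
        rw [norm_mul]
        gcongr
        refine norm_sum_le_of_le _ fun j _ => ?_
        rw [norm_mul]
        gcongr
        exact norm_apply_le_linfty_opNorm M i j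
    _ = _ := by
        simp only [← Finset.mul_sum, ← Finset.sum_mul]
        ring

end Norm

section UniformDecay

variable {X R : Type*} [NormedRing R]

/-- The powers `F x ^ n` decay exponentially, uniformly for `x` in `s`. -/
def UniformPowDecay (F : X → R) (s : Set X) : Prop :=
  ∃ r : ℝ, 0 < r ∧ r < 1 ∧ ∃ C : ℝ, 0 ≤ C ∧ ∀ x ∈ s, ∀ n : ℕ, ‖F x ^ n‖ ≤ C * r ^ n

theorem UniformPowDecay.mono {F : X → R} {s t : Set X} (h : UniformPowDecay F t) (hst : s ⊆ t) :
    UniformPowDecay F s := by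
  obtain ⟨r, hr0, hr1, C, hC, h⟩ := h
  exact ⟨r, hr0, hr1, C, hC, fun x hx => h x (hst hx)⟩

theorem UniformPowDecay.union {F : X → R} {s t : Set X} (hs : UniformPowDecay F s)
    (ht : UniformPowDecay F t) : UniformPowDecay F (s ∪ t) := by
  obtain ⟨r, hr0, hr1, C, hC, hs⟩ := hs
  obtain ⟨r', hr0', hr1', C', hC', ht⟩ := ht
  refine ⟨max r r', lt_max_of_lt_left hr0, max_lt hr1 hr1', max C C', le_max_of_le_left hC, ?_⟩
  rintro x (hx | hx) n
  · exact (hs x hx n).trans (by gcongr <;> exact le_max_left _ _)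
  · exact (ht x hx n).trans (by gcongr <;> exact le_max_right _ _)

variable [TopologicalSpace X]

/-- If `‖F x₀ ^ K‖ < 1`, then the powers of `F x` decay uniformly for `x` near `x₀`. -/
theorem exists_mem_nhds_uniformPowDecay {F : X → R} {x₀ : X} (hF : ContinuousAt F x₀) {K : ℕ}
    (hK : 0 < K) (h : ‖F x₀ ^ K‖ < 1) : ∃ t ∈ 𝓝 x₀, UniformPowDecay F t := by
  obtain ⟨q, hq0, hq1⟩ := exists_between h
  have hqpos : 0 < q := (norm_nonneg _).trans_lt hq0
  set D := max 1 (‖F x₀‖ + 1)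
  have hD : 1 ≤ D := le_max_left _ _
  have h1 : ∀ᶠ x in 𝓝 x₀, ‖F x ^ K‖ < q :=
    (hF.pow K).norm.eventually_lt continuousAt_const hq0
  have h2 : ∀ᶠ x in 𝓝 x₀, ‖F x‖ < ‖F x₀‖ + 1 :=
    hF.norm.eventually_lt continuousAt_const (by simp)
  set r := q ^ ((K : ℝ)⁻¹)
  have hr0 : 0 < r := Real.rpow_pos_of_pos hqpos _
  have hrK : r ^ K = q := Real.rpow_inv_natCast_pow hqpos.le hK.ne'
  have hr1 : r < 1 := Real.rpow_lt_one hqpos.le hq1 (by positivity)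
  -- Write n = K (n / K) + n % K. The factor D ^ K pays for the remainder, r ^ K for rounding n down
  -- to a multiple of K, and `max 1 ‖1‖` for the zeroth power, since the norm of 1 need not be 1.
  refine ⟨{x | ‖F x ^ K‖ < q ∧ ‖F x‖ < ‖F x₀‖ + 1}, h1.and h2, r, hr0, hr1,
    max 1 ‖(1 : R)‖ * D ^ K / r ^ K, by positivity, ?_⟩
  rintro x ⟨hx1, hx2⟩ n
  have hsmall : ∀ j, ‖F x ^ j‖ ≤ max 1 ‖(1 : R)‖ * D ^ j := by
    intro j
    induction j with
    | zero => simp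
    | succ j ih =>
      rw [pow_succ, pow_succ, ← mul_assoc]
      exact (norm_mul_le _ _).trans (by gcongr; exact hx2.le.trans (le_max_right _ _))
  have hdiv : ∀ a j, ‖F x ^ (K * a + j)‖ ≤ q ^ a * (max 1 ‖(1 : R)‖ * D ^ j) := by
    intro a j
    induction a with
    | zero => simpa using hsmall j
    | succ a ih =>
      rw [show K * (a + 1) + j = K + (K * a + j) by ring, pow_add, pow_succ' q, mul_assoc]
      exact (norm_mul_le _ _).trans (by gcongr)
  have hmod : n % K < K := Nat.mod_lt n hK
  calc ‖F x ^ n‖ = ‖F x ^ (K * (n / K) + n % K)‖ := by rw [Nat.div_add_mod]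
    _ ≤ q ^ (n / K) * (max 1 ‖(1 : R)‖ * D ^ (n % K)) := hdiv _ _
    _ ≤ q ^ (n / K) * (max 1 ‖(1 : R)‖ * D ^ K) := by gcongr
    _ = max 1 ‖(1 : R)‖ * D ^ K / r ^ K * r ^ (K * (n / K) + K) := by
        rw [← hrK, ← pow_mul, pow_add]
        field_simp
    _ ≤ max 1 ‖(1 : R)‖ * D ^ K / r ^ K * r ^ n := by
        gcongr ?_ * ?_
        refine pow_le_pow_of_le_one hr0.le hr1.le ?_
        have := Nat.div_add_mod n K
        omega

theorem IsCompact.uniformPowDecay {F : X → R} {s : Set X} (hs : IsCompact s)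
    (hF : ∀ x ∈ s, ContinuousAt F x) (h : ∀ x ∈ s, ∃ K : ℕ, 0 < K ∧ ‖F x ^ K‖ < 1) :
    UniformPowDecay F s := by
  refine hs.induction_on (p := UniformPowDecay F)
    ⟨1 / 2, by norm_num, by norm_num, 0, le_rfl, by simp⟩
    (fun s t hst ht => ht.mono hst) (fun s t hs ht => hs.union ht) fun x hx => ?_
  obtain ⟨K, hK, hlt⟩ := h x hx
  obtain ⟨t, ht, hdecay⟩ := exists_mem_nhds_uniformPowDecay (hF x hx) hK hlt
  exact ⟨t, mem_nhdsWithin_of_mem_nhds ht, hdecay⟩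

end UniformDecay

section Contraction

variable {ι : Type*} [Fintype ι] [DecidableEq ι]

/-- The powers of a primitive stochastic matrix approach the projection onto the constants
given by its stationary distribution. -/
theorem IsPrimitive.exists_norm_pow_sub_lt_one [Nonempty ι] {P : Matrix ι ι ℝ} {p : ι → ℝ}
    (hP : P.IsPrimitive) (h1 : P *ᵥ 1 = 1) (hp : p ᵥ* P = p) (hpos : ∀ i, 0 < p i)
    (hsum : p ⬝ᵥ 1 = 1) :
    ∃ K : ℕ, 0 < K ∧ ‖(P - vecMulVec 1 p) ^ K‖ < 1 := by
  obtain ⟨-, s, hs, hPs⟩ := hP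
  set E := vecMulVec (1 : ι → ℝ) p with hE
  have hPE : P * E = E := by rw [hE, mul_vecMulVec, h1]
  have hEP : E * P = E := by rw [hE, vecMulVec_mul, hp]
  have hEE : E * E = E := by rw [hE, vecMulVec_mul_vecMulVec, hsum]; simp
  have hEapp : ∀ i j, E i j = p j := fun i j => by simp [hE]
  have hPn : ∀ n : ℕ, P ^ n * E = E := fun n => by
    induction n with
    | zero => simp
    | succ n ih => rw [pow_succ, mul_assoc, hPE, ih]
  have hPn' : ∀ n : ℕ, E * P ^ n = E := fun n => by
    induction n with
    | zero => simp
    | succ n ih => rw [pow_succ', ← mul_assoc, hEP, ih]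
  have hP1 : ∀ n : ℕ, (P ^ n) *ᵥ 1 = 1 := fun n => by
    induction n with
    | zero => simp
    | succ n ih => rw [pow_succ, ← mulVec_mulVec, h1, ih]
  have hsub : ∀ n : ℕ, (P - E) ^ (n + 1) = P ^ (n + 1) - E := fun n => by
    induction n with
    | zero => simp
    | succ n ih =>
      rw [pow_succ, ih, sub_mul, mul_sub, mul_sub, hPn, hEP, hEE, ← pow_succ]
      abel
  obtain ⟨⟨i₀, j₀⟩, -, hmin⟩ := Finset.exists_min_image Finset.univ
    (fun q : ι × ι => (P ^ s) q.1 q.2) Finset.univ_nonempty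
  -- Doeblin's minorisation: P ^ s ≥ c E entrywise, because p j ≤ 1. What remains after subtracting
  -- c E is non-negative with row sums 1 - c, hence has norm at most 1 - c. The cap 1 / 2 keeps 1 -
  -- c positive.
  set c := min ((P ^ s) i₀ j₀) (1 / 2)
  have hc0 : 0 < c := lt_min (hPs _ _) (by norm_num)
  have hc1 : c ≤ 1 / 2 := min_le_right _ _
  have hple : ∀ j, p j ≤ 1 := fun j => by
    rw [← hsum]
    simpa [dotProduct] using Finset.single_le_sum (f := p) (fun j _ => (hpos j).le)
      (Finset.mem_univ j)
  set Q := P ^ s - c • E with hQ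
  have hQ0 : ∀ i j, 0 ≤ Q i j := fun i j => by
    have h2 : c ≤ (P ^ s) i j := (min_le_left _ _).trans (hmin (i, j) (Finset.mem_univ _))
    have h3 : c * p j ≤ c := mul_le_of_le_one_right hc0.le (hple j)
    simp only [hQ, sub_apply, smul_apply, hEapp, smul_eq_mul]
    linarith
  have hQ1 : ∀ i, ∑ j, Q i j = 1 - c := fun i => by
    have h2 := congrFun (hP1 s) i
    simp only [mulVec, dotProduct, Pi.one_apply, mul_one] at h2 hsum
    simp only [hQ, sub_apply, smul_apply, hEapp, smul_eq_mul, Finset.sum_sub_distrib, h2,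
      ← Finset.mul_sum, hsum, mul_one]
  have hQn : ‖Q‖ ≤ 1 - c := by
    refine linfty_opNorm_le_of_forall_sum_le (by linarith) fun i => le_of_eq ?_
    rw [← hQ1 i]
    exact Finset.sum_congr rfl fun j _ => by rw [Real.norm_of_nonneg (hQ0 i j)]
  -- The factor 1 - E is an idempotent commuting with Q, so it appears only once in every power and
  -- the norm decays like (1 - c) ^ k.
  have hfac : P ^ s - E = Q * (1 - E) := by
    rw [hQ, mul_sub, mul_one, sub_mul, hPn, smul_mul_assoc, hEE]
    abel
  have hcomm : Commute Q (1 - E) := by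
    refine (Commute.one_right _).sub_right ?_
    rw [Commute, SemiconjBy, hQ, sub_mul, mul_sub, hPn, hPn', smul_mul_assoc, mul_smul_comm]
  have hidem : IsIdempotentElem (1 - E) := IsIdempotentElem.one_sub hEE
  have hpow : ∀ k : ℕ, (P - E) ^ (s * (k + 1)) = Q ^ (k + 1) * (1 - E) := fun k => by
    obtain ⟨s', rfl⟩ : ∃ s', s = s' + 1 := ⟨s - 1, by omega⟩
    rw [pow_mul, hsub, hfac, hcomm.mul_pow, hidem.pow_succ_eq]
  have hlim : Tendsto (fun k : ℕ => (1 - c) ^ (k + 1) * ‖1 - E‖) atTop (𝓝 0) := by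
    have := ((tendsto_pow_atTop_nhds_zero_of_lt_one (by linarith : (0 : ℝ) ≤ 1 - c)
      (by linarith)).comp (tendsto_add_atTop_nat 1)).mul_const ‖1 - E‖
    simpa using this
  obtain ⟨k, hk⟩ := (hlim.eventually_lt_const one_pos).exists
  refine ⟨s * (k + 1), by positivity, ?_⟩
  rw [hpow]
  refine lt_of_le_of_lt ?_ hk
  refine (norm_mul_le _ _).trans ?_
  gcongr
  exact (norm_pow_le' Q (Nat.succ_pos k)).trans (by gcongr)

end Contraction

section Analytic

variable {ι : Type*} [Fintype ι] [DecidableEq ι] {𝕜 E : Type*} [NontriviallyNormedField 𝕜]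
  [NormedAddCommGroup E] [NormedSpace 𝕜 E]

theorem analyticAt_det {K : E → Matrix ι ι 𝕜} {x : E}
    (hK : ∀ i j, AnalyticAt 𝕜 (fun y => K y i j) x) : AnalyticAt 𝕜 (fun y => (K y).det) x := by
  simp only [det_apply']
  exact Finset.analyticAt_fun_sum _ fun σ _ =>
    analyticAt_const.mul (Finset.analyticAt_fun_prod _ fun i _ => hK _ _)

theorem analyticAt_inv_apply {K : E → Matrix ι ι 𝕜} {x : E}
    (hK : ∀ i j, AnalyticAt 𝕜 (fun y => K y i j) x) (hdet : (K x).det ≠ 0) (i j : ι) :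
    AnalyticAt 𝕜 (fun y => (K y)⁻¹ i j) x := by
  simp only [inv_def, smul_apply, adjugate_apply, smul_eq_mul, Ring.inverse_eq_inv']
  refine ((analyticAt_det hK).inv hdet).mul (analyticAt_det fun a b => ?_)
  by_cases h : a = j
  · subst h
    simpa using analyticAt_const
  · simpa [updateRow_apply, h] using hK a b

end Analytic

end Matrix

/-! ### Stochastic pairs and the analytic eigenvalue branch. -/

/-- Non-negative matrices `A`, `B` with `A + B` primitive and stochastic, and with stationary
distribution `p`. -/
structure IsStochasticPair {m : ℕ} (A B : Matrix (Fin m) (Fin m) ℝ) (p : Fin m → ℝ) : Prop where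
  nonneg_left : ∀ i j, 0 ≤ A i j
  nonneg_right : ∀ i j, 0 ≤ B i j
  isPrimitive : (A + B).IsPrimitive
  mulVec_one : (A + B) *ᵥ 1 = 1
  vecMul_eq : p ᵥ* (A + B) = p
  pos : ∀ i, 0 < p i
  sum_eq_one : p ⬝ᵥ 1 = 1

/-- The matrix `A e^z + B`. -/
noncomputable def expTwist {m : ℕ} (A B : Matrix (Fin m) (Fin m) ℝ) (z : ℂ) :
    Matrix (Fin m) (Fin m) ℂ :=
  Complex.exp z • A.map Complex.ofReal + B.map Complex.ofReal

/-- The complexification of a real vector. -/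
def complexVec {m : ℕ} (p : Fin m → ℝ) : Fin m → ℂ := fun i => (p i : ℂ)

/-- The matrix `x - A e^z - B + 1 p'`. -/
noncomputable def borderedTwist {m : ℕ} (A B : Matrix (Fin m) (Fin m) ℝ) (p : Fin m → ℝ)
    (z x : ℂ) : Matrix (Fin m) (Fin m) ℂ :=
  x • 1 - expTwist A B z + Matrix.vecMulVec 1 (complexVec p)

namespace IsStochasticPair

open Matrix Filter
open scoped Matrix.Norms.Operator

variable {m : ℕ} {A B : Matrix (Fin m) (Fin m) ℝ} {p : Fin m → ℝ}

theorem nonempty (h : IsStochasticPair A B p) : Nonempty (Fin m) := by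
  by_contra hne
  rw [not_nonempty_iff] at hne
  simpa using h.sum_eq_one

/-- On vectors orthogonal to p the matrix A + B agrees with A + B - 1p', a power of which is a
strict contraction. This is the simplicity of the eigenvalue 1. -/
theorem eq_zero_of_fixed (h : IsStochasticPair A B p) {y : Fin m → ℝ}
    (hy : (A + B) *ᵥ y = y) (hpy : p ⬝ᵥ y = 0) : y = 0 := by
  have := h.nonempty
  obtain ⟨K, hK, hlt⟩ := h.isPrimitive.exists_norm_pow_sub_lt_one h.mulVec_one h.vecMul_eq h.pos
    h.sum_eq_one
  set N := A + B - vecMulVec 1 p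
  have hN : N *ᵥ y = y := by
    rw [sub_mulVec, hy, vecMulVec_mulVec, hpy]
    simp
  have hNn : ∀ n : ℕ, (N ^ n) *ᵥ y = y := fun n => by
    induction n with
    | zero => simp
    | succ n ih => rw [pow_succ, ← mulVec_mulVec, hN, ih]
  by_contra hne
  have h1 := linfty_opNorm_mulVec (N ^ K) y
  rw [hNn] at h1
  have h2 : 0 < ‖y‖ := norm_pos_iff.mpr hne
  nlinarith

theorem eq_zero_of_complex_fixed (h : IsStochasticPair A B p) {y : Fin m → ℂ}
    (hy : (A + B).map Complex.ofReal *ᵥ y = y) (hpy : complexVec p ⬝ᵥ y = 0) : y = 0 := by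
  have hre : (fun i => (y i).re) = 0 := by
    refine h.eq_zero_of_fixed (funext fun i => ?_) ?_
    · have := congrArg Complex.re (congrFun hy i)
      simpa [mulVec, dotProduct, -Complex.ofReal_add, -map_add, ← Complex.ofReal_add] using this
    · have := congrArg Complex.re hpy
      simpa [dotProduct, complexVec] using this
  have him : (fun i => (y i).im) = 0 := by
    refine h.eq_zero_of_fixed (funext fun i => ?_) ?_
    · have := congrArg Complex.im (congrFun hy i)
      simpa [mulVec, dotProduct, -Complex.ofReal_add, -map_add, ← Complex.ofReal_add] using this
    · have := congrArg Complex.im hpy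
      simpa [dotProduct, complexVec] using this
  exact funext fun i => Complex.ext (congrFun hre i) (congrFun him i)

theorem expTwist_zero : expTwist A B 0 = (A + B).map Complex.ofReal := by
  ext i j
  simp [expTwist]

theorem expTwist_zero_mulVec_one (h : IsStochasticPair A B p) : expTwist A B 0 *ᵥ 1 = 1 := by
  rw [expTwist_zero]
  ext i
  have := congrArg Complex.ofReal (congrFun h.mulVec_one i)
  simpa [mulVec, dotProduct] using this

theorem vecMul_expTwist_zero (h : IsStochasticPair A B p) :
    complexVec p ᵥ* expTwist A B 0 = complexVec p := by
  rw [expTwist_zero]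
  ext i
  have := congrArg Complex.ofReal (congrFun h.vecMul_eq i)
  simpa [vecMul, dotProduct, complexVec] using this

theorem complexVec_dotProduct_one (h : IsStochasticPair A B p) : complexVec p ⬝ᵥ 1 = 1 := by
  have := congrArg Complex.ofReal h.sum_eq_one
  simpa [dotProduct, complexVec] using this

theorem borderedTwist_mulVec (z x : ℂ) (y : Fin m → ℂ) :
    borderedTwist A B p z x *ᵥ y =
      (x • y - expTwist A B z *ᵥ y) + (complexVec p ⬝ᵥ y) • 1 := by
  rw [borderedTwist, add_mulVec, sub_mulVec, smul_mulVec, one_mulVec, vecMulVec_mulVec]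
  simp

theorem vecMul_borderedTwist (z x : ℂ) (y : Fin m → ℂ) :
    y ᵥ* borderedTwist A B p z x =
      (x • y - y ᵥ* expTwist A B z) + (y ⬝ᵥ 1) • complexVec p := by
  rw [borderedTwist, vecMul_add, vecMul_sub, vecMul_smul, vecMul_one, vecMul_vecMulVec]

/-- The rank-one term removes the singularity of x - A e^z - B at (0, 1): pairing a kernel vector
with p shows that it is orthogonal to p, hence fixed by A + B, hence zero. The inverse is therefore
analytic near (0, 1), and eigenvectors can be read off from it. -/
theorem det_borderedTwist_ne_zero (h : IsStochasticPair A B p) :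
    (borderedTwist A B p 0 1).det ≠ 0 := by
  intro hdet
  obtain ⟨y, hy0, hy⟩ := exists_mulVec_eq_zero_iff.mpr hdet
  rw [borderedTwist_mulVec, one_smul] at hy
  have h1 := congrArg (complexVec p ⬝ᵥ ·) hy
  simp only [dotProduct_add, dotProduct_sub, dotProduct_smul, h.complexVec_dotProduct_one,
    dotProduct_mulVec, h.vecMul_expTwist_zero, sub_self, zero_add, smul_eq_mul, mul_one,
    dotProduct_zero] at h1
  rw [h1, zero_smul, add_zero, sub_eq_zero, expTwist_zero] at hy
  exact hy0 (h.eq_zero_of_complex_fixed hy.symm h1)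

/-- `(x - A e^z - B + 1 p')⁻¹ 1`, a right eigenvector if `x` is an eigenvalue of `A e^z + B`. -/
noncomputable def rightVec (A B : Matrix (Fin m) (Fin m) ℝ) (p : Fin m → ℝ) (z x : ℂ) :
    Fin m → ℂ :=
  (borderedTwist A B p z x)⁻¹ *ᵥ 1

/-- `p' (x - A e^z - B + 1 p')⁻¹`, a left eigenvector if `x` is an eigenvalue of
`A e^z + B`. -/
noncomputable def leftVec (A B : Matrix (Fin m) (Fin m) ℝ) (p : Fin m → ℝ) (z x : ℂ) :
    Fin m → ℂ :=
  complexVec p ᵥ* (borderedTwist A B p z x)⁻¹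

theorem analyticAt_borderedTwist_apply (i j : Fin m) (q : ℂ × ℂ) :
    AnalyticAt ℂ (fun q : ℂ × ℂ => borderedTwist A B p q.1 q.2 i j) q := by
  simp only [borderedTwist, expTwist, Matrix.add_apply, Matrix.sub_apply, Matrix.smul_apply,
    smul_eq_mul]
  have h1 : AnalyticAt ℂ (fun q : ℂ × ℂ => q.1) q := analyticAt_fst
  have h2 : AnalyticAt ℂ (fun q : ℂ × ℂ => q.2) q := analyticAt_snd
  exact ((h2.mul analyticAt_const).sub ((h1.cexp.mul analyticAt_const).add analyticAt_const)).add
    analyticAt_const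

theorem eventually_det_borderedTwist_ne_zero (h : IsStochasticPair A B p) :
    ∀ᶠ q : ℂ × ℂ in 𝓝 (0, 1), (borderedTwist A B p q.1 q.2).det ≠ 0 :=
  (analyticAt_det fun i j => analyticAt_borderedTwist_apply i j (0, 1)).continuousAt.eventually_ne
    h.det_borderedTwist_ne_zero

theorem analyticAt_rightVec_apply (h : IsStochasticPair A B p) (i : Fin m) :
    AnalyticAt ℂ (fun q : ℂ × ℂ => rightVec A B p q.1 q.2 i) (0, 1) := by
  simp only [rightVec, mulVec, dotProduct, Pi.one_apply, mul_one]
  exact Finset.analyticAt_fun_sum _ fun j _ =>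
    analyticAt_inv_apply (fun i j => analyticAt_borderedTwist_apply i j (0, 1))
      h.det_borderedTwist_ne_zero i j

theorem analyticAt_leftVec_apply (h : IsStochasticPair A B p) (i : Fin m) :
    AnalyticAt ℂ (fun q : ℂ × ℂ => leftVec A B p q.1 q.2 i) (0, 1) := by
  simp only [leftVec, vecMul, dotProduct]
  exact Finset.analyticAt_fun_sum _ fun j _ => analyticAt_const.mul
    (analyticAt_inv_apply (fun i j => analyticAt_borderedTwist_apply i j (0, 1))
      h.det_borderedTwist_ne_zero j i)

theorem borderedTwist_mulVec_rightVec {z x : ℂ} (hdet : (borderedTwist A B p z x).det ≠ 0) :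
    borderedTwist A B p z x *ᵥ rightVec A B p z x = 1 := by
  rw [rightVec, mulVec_mulVec, mul_nonsing_inv _ hdet.isUnit, one_mulVec]

theorem eq_rightVec {z x : ℂ} (hdet : (borderedTwist A B p z x).det ≠ 0) {y : Fin m → ℂ} {c : ℂ}
    (hy : borderedTwist A B p z x *ᵥ y = c • 1) : y = c • rightVec A B p z x := by
  rw [rightVec, ← mulVec_smul, ← hy, mulVec_mulVec, nonsing_inv_mul _ hdet.isUnit, one_mulVec]

theorem eq_leftVec {z x : ℂ} (hdet : (borderedTwist A B p z x).det ≠ 0) {y : Fin m → ℂ} {c : ℂ}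
    (hy : y ᵥ* borderedTwist A B p z x = c • complexVec p) : y = c • leftVec A B p z x := by
  rw [leftVec, ← smul_vecMul, ← hy, vecMul_vecMul, mul_nonsing_inv _ hdet.isUnit, vecMul_one]

theorem rightVec_zero (h : IsStochasticPair A B p) {x : ℂ} (hx : x ≠ 0)
    (hdet : (borderedTwist A B p 0 x).det ≠ 0) : rightVec A B p 0 x = x⁻¹ • 1 := by
  have h1 : borderedTwist A B p 0 x *ᵥ 1 = x • 1 := by
    rw [borderedTwist_mulVec, h.expTwist_zero_mulVec_one, h.complexVec_dotProduct_one]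
    simp
  rw [eq_inv_smul_iff₀ hx, ← eq_rightVec hdet h1]

theorem rightVec_zero_one (h : IsStochasticPair A B p) : rightVec A B p 0 1 = 1 := by
  simpa using h.rightVec_zero one_ne_zero h.det_borderedTwist_ne_zero

theorem leftVec_zero_one (h : IsStochasticPair A B p) : leftVec A B p 0 1 = complexVec p := by
  have h1 : complexVec p ᵥ* borderedTwist A B p 0 1 = (1 : ℂ) • complexVec p := by
    rw [vecMul_borderedTwist, h.vecMul_expTwist_zero, h.complexVec_dotProduct_one]
    simp
  simpa using (eq_leftVec h.det_borderedTwist_ne_zero h1).symm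

theorem det_sub_expTwist (x z : ℂ) :
    (x • (1 : Matrix (Fin m) (Fin m) ℂ) - Complex.exp z • A.map Complex.ofReal
      - B.map Complex.ofReal).det = (x • 1 - expTwist A B z).det := by
  rw [expTwist, sub_sub]

/-- If `x` is an eigenvalue of `A e^z + B`, then `rightVec` is an eigenvector for it. -/
theorem rightVec_spec {z x : ℂ} (hdet : (borderedTwist A B p z x).det ≠ 0)
    (hx : (x • 1 - expTwist A B z).det = 0) :
    complexVec p ⬝ᵥ rightVec A B p z x = 1 ∧
      expTwist A B z *ᵥ rightVec A B p z x = x • rightVec A B p z x := by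
  obtain ⟨y, hy0, hy⟩ := exists_mulVec_eq_zero_iff.mpr hx
  rw [sub_mulVec, smul_mulVec, one_mulVec] at hy
  -- On an eigenvector y only the rank-one term survives, so y is a multiple of `rightVec`; the
  -- multiple p·y is non-zero since y is.
  have h1 : borderedTwist A B p z x *ᵥ y = (complexVec p ⬝ᵥ y) • 1 := by
    rw [borderedTwist_mulVec, hy, zero_add]
  have h2 := eq_rightVec hdet h1
  have hc : complexVec p ⬝ᵥ y ≠ 0 := fun hc => hy0 (by rw [h2, hc, zero_smul])
  constructor
  · have h3 := congrArg (complexVec p ⬝ᵥ ·) h2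
    simp only [dotProduct_smul, smul_eq_mul] at h3
    exact (mul_left_cancel₀ hc (by rw [mul_one]; exact h3)).symm
  · rw [sub_eq_zero, h2, mulVec_smul, smul_comm] at hy
    exact (smul_right_injective _ hc hy).symm

theorem leftVec_spec {z x : ℂ} (hdet : (borderedTwist A B p z x).det ≠ 0)
    (hx : (x • 1 - expTwist A B z).det = 0) :
    leftVec A B p z x ᵥ* expTwist A B z = x • leftVec A B p z x := by
  obtain ⟨y, hy0, hy⟩ := exists_vecMul_eq_zero_iff.mpr hx
  rw [vecMul_sub, vecMul_smul, vecMul_one] at hy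
  have h1 : y ᵥ* borderedTwist A B p z x = (y ⬝ᵥ 1) • complexVec p := by
    rw [vecMul_borderedTwist, hy, zero_add]
  have h2 := eq_leftVec hdet h1
  have hc : y ⬝ᵥ 1 ≠ 0 := fun hc => hy0 (by rw [h2, hc, zero_smul])
  rw [sub_eq_zero, h2, smul_vecMul, smul_comm] at hy
  exact (smul_right_injective _ hc hy).symm

/-- Where the bordered matrix is invertible, p · `rightVec` = 1 says that `rightVec` is an
eigenvector. The implicit function theorem solves this equation for x: at z = 0 its left side is
1/x, with derivative -1 at x = 1. -/
theorem exists_branch (h : IsStochasticPair A B p) : ∃ u, IsEigenvalueBranch A B 1 u := by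
  have := h.nonempty
  set f : ℂ × ℂ → ℂ := fun q => complexVec p ⬝ᵥ rightVec A B p q.1 q.2 with hf
  have hfa : AnalyticAt ℂ f (0, 1) := by
    simp only [hf, dotProduct]
    exact Finset.analyticAt_fun_sum _ fun i _ => analyticAt_const.mul
      (h.analyticAt_rightVec_apply i)
  have hcd : ContDiffAt ℂ ⊤ f (0, 1) := hfa.contDiffAt
  have htend : Tendsto (fun x : ℂ => ((0 : ℂ), x)) (𝓝 1) (𝓝 (0, 1)) :=
    (by fun_prop : Continuous fun x : ℂ => ((0 : ℂ), x)).tendsto 1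
  have hf0 : (fun x => f (0, x)) =ᶠ[𝓝 1] fun x => x⁻¹ := by
    filter_upwards [htend.eventually h.eventually_det_borderedTwist_ne_zero,
      isOpen_ne.mem_nhds (one_ne_zero : (1 : ℂ) ≠ 0)] with x hx hx0
    simp only [hf, h.rightVec_zero hx0 hx, dotProduct_smul, h.complexVec_dotProduct_one,
      smul_eq_mul, mul_one]
  have hderiv : fderiv ℂ f (0, 1) (0, 1) = -1 := by
    have h1 : HasDerivAt (fun x : ℂ => f (0, x)) (fderiv ℂ f (0, 1) (0, 1)) 1 := by
      have h2 : HasDerivAt (fun x : ℂ => ((0 : ℂ), x)) (0, 1) 1 :=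
        (hasDerivAt_const _ _).prodMk (hasDerivAt_id _)
      exact (hfa.differentiableAt.hasFDerivAt (x := ((0 : ℂ), (1 : ℂ)))).comp_hasDerivAt 1 h2
    have h3 := (hasDerivAt_inv (one_ne_zero : (1 : ℂ) ≠ 0)).congr_of_eventuallyEq hf0
    simpa using h1.unique h3
  have hinv : (fderiv ℂ f (0, 1) ∘L .inr ℂ ℂ ℂ).IsInvertible := by
    refine ⟨ContinuousLinearEquiv.neg ℂ, ?_⟩
    ext
    simp [hderiv]
  have hn : (⊤ : WithTop ℕ∞) ≠ 0 := by simp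
  refine ⟨hcd.implicitFunction hn hinv, ?_, ?_, ?_⟩
  · exact (hcd.contDiffAt_implicitFunction hn hinv).analyticAt
  · simpa using hcd.implicitFunction_apply_self hn hinv
  · have hcont : ContinuousAt (hcd.implicitFunction hn hinv) 0 :=
      (hcd.contDiffAt_implicitFunction hn hinv).continuousAt
    have h0 : hcd.implicitFunction hn hinv 0 = 1 := hcd.implicitFunction_apply_self hn hinv
    have htend : Tendsto (fun z => (z, hcd.implicitFunction hn hinv z)) (𝓝 0) (𝓝 (0, 1)) := by
      have h1 := (continuousAt_id.prodMk hcont).tendsto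
      rwa [h0] at h1
    filter_upwards [htend.eventually h.eventually_det_borderedTwist_ne_zero,
      hcd.eventually_apply_implicitFunction hn hinv] with z hdet hz
    rw [det_sub_expTwist, ← exists_mulVec_eq_zero_iff]
    have hf1 : f (0, 1) = 1 := by
      simp only [hf, h.rightVec_zero_one, h.complexVec_dotProduct_one]
    have h1 := borderedTwist_mulVec_rightVec hdet
    rw [hf1] at hz
    simp only [hf] at hz
    refine ⟨rightVec A B p z (hcd.implicitFunction hn hinv z), fun h2 => ?_, ?_⟩
    · rw [h2] at hz
      simp at hz
    · rw [borderedTwist_mulVec, hz, one_smul, add_eq_right] at h1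
      rwa [sub_mulVec, smul_mulVec, one_mulVec]

end IsStochasticPair

/-- The idempotent E is a spectral projection, so T - u E and u E annihilate each other. The
exponent n + 1 matters: the zeroth powers would leave 1 on one side and 1 - E on the other. -/
theorem sub_smul_pow_succ_of_mul_eq {R : Type*} [Ring R] [Algebra ℂ R] {T E : R} {u : ℂ}
    (hTE : T * E = u • E) (hET : E * T = u • E) (hEE : E * E = E) (n : ℕ) :
    (T - u • E) ^ (n + 1) = T ^ (n + 1) - u ^ (n + 1) • E := by
  have hTn : ∀ n : ℕ, T ^ n * E = u ^ n • E := fun n => by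
    induction n with
    | zero => simp
    | succ n ih => rw [pow_succ, mul_assoc, hTE, mul_smul_comm, ih, smul_smul, pow_succ']
  induction n with
  | zero => simp
  | succ n ih =>
    rw [pow_succ, ih, sub_mul, mul_sub, mul_sub, mul_smul_comm, hTn, smul_mul_assoc, hET,
      smul_mul_smul_comm, hEE, smul_smul, smul_smul, ← pow_succ, ← pow_succ, ← pow_succ']
    abel

/-! ### Quasi-powers and the derivatives of the branch. -/

namespace IsStochasticPair

open Matrix Filter
open scoped Matrix.Norms.Operator

variable {m : ℕ} {A B : Matrix (Fin m) (Fin m) ℝ} {p : Fin m → ℝ} {u : ℂ → ℂ}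

theorem continuousAt_expTwist (z : ℂ) : ContinuousAt (expTwist A B) z := by
  refine continuousAt_pi.mpr fun i => continuousAt_pi.mpr fun j => ?_
  simp only [expTwist, Matrix.add_apply, Matrix.smul_apply, smul_eq_mul]
  fun_prop

theorem analyticAt_comp_branch {F : ℂ × ℂ → ℂ} (hF : AnalyticAt ℂ F (0, 1))
    (hu : IsEigenvalueBranch A B 1 u) : AnalyticAt ℂ (fun z => F (z, u z)) 0 := by
  have h1 : AnalyticAt ℂ (fun z => (z, u z)) 0 := analyticAt_id.prod hu.1
  refine AnalyticAt.fun_comp_of_eq hF h1 ?_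
  rw [hu.2.1, Complex.ofReal_one]

theorem tendsto_branch (hu : IsEigenvalueBranch A B 1 u) :
    Tendsto (fun z => (z, u z)) (𝓝 0) (𝓝 ((0 : ℂ), (1 : ℂ))) := by
  have h1 := hu.1.continuousAt.tendsto
  rw [hu.2.1, Complex.ofReal_one] at h1
  exact tendsto_id.prodMk_nhds h1

theorem analyticAt_rightVec_branch (h : IsStochasticPair A B p)
    (hu : IsEigenvalueBranch A B 1 u) (i : Fin m) :
    AnalyticAt ℂ (fun z => rightVec A B p z (u z) i) 0 :=
  analyticAt_comp_branch (h.analyticAt_rightVec_apply i) hu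

theorem analyticAt_leftVec_branch (h : IsStochasticPair A B p)
    (hu : IsEigenvalueBranch A B 1 u) (i : Fin m) :
    AnalyticAt ℂ (fun z => leftVec A B p z (u z) i) 0 :=
  analyticAt_comp_branch (h.analyticAt_leftVec_apply i) hu

theorem rightVec_branch_zero (h : IsStochasticPair A B p) (hu : IsEigenvalueBranch A B 1 u) :
    rightVec A B p 0 (u 0) = 1 := by
  rw [hu.2.1, Complex.ofReal_one, h.rightVec_zero_one]

theorem leftVec_branch_zero (h : IsStochasticPair A B p) (hu : IsEigenvalueBranch A B 1 u) :
    leftVec A B p 0 (u 0) = complexVec p := by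
  rw [hu.2.1, Complex.ofReal_one, h.leftVec_zero_one]

theorem eventually_eigenvectors (h : IsStochasticPair A B p) (hu : IsEigenvalueBranch A B 1 u) :
    ∀ᶠ z in 𝓝 (0 : ℂ), complexVec p ⬝ᵥ rightVec A B p z (u z) = 1 ∧
      expTwist A B z *ᵥ rightVec A B p z (u z) = u z • rightVec A B p z (u z) ∧
      leftVec A B p z (u z) ᵥ* expTwist A B z = u z • leftVec A B p z (u z) := by
  filter_upwards [(tendsto_branch hu).eventually h.eventually_det_borderedTwist_ne_zero,
    hu.2.2] with z hdet hz
  rw [det_sub_expTwist] at hz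
  exact ⟨(rightVec_spec hdet hz).1, (rightVec_spec hdet hz).2, leftVec_spec hdet hz⟩

/-- Near `0`, the bilinear form of `(A e^z + B) ^ n` is a quasi-power. -/
theorem quasi_power (h : IsStochasticPair A B p) (hu : IsEigenvalueBranch A B 1 u)
    (x y : Fin m → ℂ) :
    ∃ r : ℂ → ℂ, AnalyticAt ℂ r 0 ∧ r 0 = (x ⬝ᵥ 1) * (complexVec p ⬝ᵥ y) ∧
      ∃ ρ : ℝ, 0 < ρ ∧ ρ < 1 ∧ ∃ C : ℝ, 0 ≤ C ∧ ∀ᶠ z in 𝓝 (0 : ℂ), ∀ n : ℕ, 1 ≤ n →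
        ‖x ⬝ᵥ (expTwist A B z ^ n *ᵥ y) - u z ^ n * r z‖ ≤ C * ρ ^ n := by
  have := h.nonempty
  set v : ℂ → Fin m → ℂ := fun z => rightVec A B p z (u z) with hv
  set w : ℂ → Fin m → ℂ := fun z => leftVec A B p z (u z) with hw
  have hva : ∀ i, AnalyticAt ℂ (fun z => v z i) 0 := h.analyticAt_rightVec_branch hu
  have hwa : ∀ i, AnalyticAt ℂ (fun z => w z i) 0 := h.analyticAt_leftVec_branch hu
  have hv0 : v 0 = 1 := h.rightVec_branch_zero hu
  have hw0 : w 0 = complexVec p := h.leftVec_branch_zero hu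
  set s : ℂ → ℂ := fun z => w z ⬝ᵥ v z with hs
  have hsa : AnalyticAt ℂ s 0 := by
    simp only [hs, dotProduct]
    exact Finset.analyticAt_fun_sum _ fun i _ => (hwa i).mul (hva i)
  have hs0 : s 0 = 1 := by
    simp only [hs, hv0, hw0, h.complexVec_dotProduct_one]
  -- The spectral projection onto the branch, normalised by w·v. At z = 0 the remainder N is A + B -
  -- 1p', so its powers decay there, and by continuity also nearby. The prefactor r below is
  -- x'E(z)y.
  set E : ℂ → Matrix (Fin m) (Fin m) ℂ := fun z => (s z)⁻¹ • vecMulVec (v z) (w z) with hE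
  set N : ℂ → Matrix (Fin m) (Fin m) ℂ := fun z => expTwist A B z - u z • E z with hN
  have hNcont : ContinuousAt N 0 := by
    refine (continuousAt_expTwist 0).sub (hu.1.continuousAt.smul ?_)
    refine continuousAt_pi.mpr fun i => continuousAt_pi.mpr fun j => ?_
    simp only [hE, Matrix.smul_apply, vecMulVec_apply, smul_eq_mul]
    exact (hsa.continuousAt.inv₀ (by rw [hs0]; exact one_ne_zero)).mul
      ((hva i).continuousAt.mul (hwa j).continuousAt)
  obtain ⟨K, hK, hlt⟩ := h.isPrimitive.exists_norm_pow_sub_lt_one h.mulVec_one h.vecMul_eq h.pos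
    h.sum_eq_one
  have hN0 : N 0 = (A + B - vecMulVec 1 p).map Complex.ofRealHom := by
    simp only [hN, hE, hs0, hv0, hw0, hu.2.1, expTwist_zero]
    ext i j
    simp [complexVec]
  have hN0K : ‖N 0 ^ K‖ < 1 := by
    rw [hN0, ← Matrix.map_pow]
    exact (linfty_opNorm_map_ofReal _).trans_lt hlt
  obtain ⟨t, ht, ρ, hρ0, hρ1, C, hC, hdecay⟩ := exists_mem_nhds_uniformPowDecay hNcont hK hN0K
  refine ⟨fun z => (s z)⁻¹ * ((x ⬝ᵥ v z) * (w z ⬝ᵥ y)), ?_, ?_, ρ, hρ0, hρ1,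
    (∑ i, ‖x i‖) * (∑ j, ‖y j‖) * C, by positivity, ?_⟩
  · refine (hsa.inv (by rw [hs0]; exact one_ne_zero)).mul ?_
    simp only [dotProduct]
    exact (Finset.analyticAt_fun_sum _ fun i _ => analyticAt_const.mul (hva i)).mul
      (Finset.analyticAt_fun_sum _ fun i _ => (hwa i).mul analyticAt_const)
  · simp only [hs0, hv0, hw0, inv_one, one_mul]
  filter_upwards [ht, h.eventually_eigenvectors hu,
    hsa.continuousAt.eventually_ne (by rw [hs0]; exact one_ne_zero)]
    with z hz ⟨_, hTv, hwT⟩ hsz n hn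
  obtain ⟨n, rfl⟩ : ∃ k, n = k + 1 := ⟨n - 1, by omega⟩
  have hTE : expTwist A B z * E z = u z • E z := by
    simp only [hE, mul_smul_comm, mul_vecMulVec]
    rw [hTv, smul_vecMulVec, smul_comm]
  have hET : E z * expTwist A B z = u z • E z := by
    simp only [hE, smul_mul_assoc, vecMulVec_mul]
    rw [hwT, vecMulVec_smul, smul_comm]
  have hEE : E z * E z = E z := by
    simp only [hE, smul_mul_smul_comm, vecMulVec_mul_vecMulVec]
    rw [vecMulVec_smul, smul_smul]
    congr 1
    change _ * s z = _
    field_simp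
  have hpow := sub_smul_pow_succ_of_mul_eq hTE hET hEE n
  have heq : x ⬝ᵥ (expTwist A B z ^ (n + 1) *ᵥ y) -
      u z ^ (n + 1) * ((s z)⁻¹ * ((x ⬝ᵥ v z) * (w z ⬝ᵥ y))) = x ⬝ᵥ (N z ^ (n + 1) *ᵥ y) := by
    rw [hpow, sub_mulVec, dotProduct_sub, smul_mulVec, dotProduct_smul]
    simp only [hE, smul_mulVec, dotProduct_smul, smul_eq_mul]
    rw [vecMulVec_mulVec, op_smul_eq_smul, dotProduct_smul, smul_eq_mul]
    ring
  rw [heq]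
  refine (norm_dotProduct_mulVec_le _ x y).trans ?_
  rw [mul_assoc _ C]
  gcongr
  exact hdecay z hz (n + 1)

/-- The derivatives of an eigenvalue branch at `0`, in terms of a solution `g` of the Poisson
equation. -/
theorem branch_derivatives (h : IsStochasticPair A B p) (hu : IsEigenvalueBranch A B 1 u) :
    ∃ g : Fin m → ℂ, complexVec p ⬝ᵥ g = 0 ∧
      A.map Complex.ofReal *ᵥ 1 + (A + B).map Complex.ofReal *ᵥ g = deriv u 0 • 1 + g ∧
      deriv u 0 = complexVec p ⬝ᵥ (A.map Complex.ofReal *ᵥ 1) ∧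
      iteratedDeriv 2 u 0 = complexVec p ⬝ᵥ (A.map Complex.ofReal *ᵥ 1) +
        2 * (complexVec p ⬝ᵥ (A.map Complex.ofReal *ᵥ g)) := by
  set v : ℂ → Fin m → ℂ := fun z => rightVec A B p z (u z) with hv
  have hva : ∀ i, AnalyticAt ℂ (fun z => v z i) 0 := h.analyticAt_rightVec_branch hu
  have hv0 : v 0 = 1 := h.rightVec_branch_zero hu
  set g : Fin m → ℂ := fun i => deriv (fun z => v z i) 0 with hg
  have hvd : ∀ i, HasDerivAt (fun z => v z i) (g i) 0 := fun i =>
    (hva i).differentiableAt.hasDerivAt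
  have hud : HasDerivAt u (deriv u 0) 0 := hu.1.differentiableAt.hasDerivAt
  have hev := h.eventually_eigenvectors hu
  set a : Fin m → ℂ := complexVec p ᵥ* A.map Complex.ofReal with ha
  set φ : ℂ → ℂ := fun z => a ⬝ᵥ v z with hφ
  have hφa : AnalyticAt ℂ φ 0 := by
    simp only [hφ, dotProduct]
    exact Finset.analyticAt_fun_sum _ fun i _ => analyticAt_const.mul (hva i)
  have hφ0 : φ 0 = complexVec p ⬝ᵥ (A.map Complex.ofReal *ᵥ 1) := by
    simp only [hφ, hv0, ha, dotProduct_mulVec]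
  have hφd : deriv φ 0 = complexVec p ⬝ᵥ (A.map Complex.ofReal *ᵥ g) := by
    rw [dotProduct_mulVec]
    refine HasDerivAt.deriv ?_
    simp only [hφ, dotProduct]
    exact HasDerivAt.fun_sum fun i _ => (hvd i).const_mul _
  have hsplit : ∀ z, expTwist A B z =
      expTwist A B 0 + (Complex.exp z - 1) • A.map Complex.ofReal := fun z => by
    simp only [expTwist, Complex.exp_zero, sub_smul, one_smul]
    abel
  -- Pair the eigenvector equation with p, using p·v = 1 and p'(A + B) = p'. As e^z - 1 vanishes at
  -- 0, the second derivative of u needs only the first derivative g of v.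
  have huφ : u =ᶠ[𝓝 0] fun z => 1 + (Complex.exp z - 1) * φ z := by
    filter_upwards [hev] with z ⟨h1, h2, _⟩
    have h3 := congrArg (complexVec p ⬝ᵥ ·) h2
    simp only [dotProduct_smul, smul_eq_mul] at h3
    rw [h1, mul_one, dotProduct_mulVec, hsplit, vecMul_add, vecMul_smul, h.vecMul_expTwist_zero,
      add_dotProduct, smul_dotProduct, h1, smul_eq_mul] at h3
    exact h3.symm
  have hud' : deriv u =ᶠ[𝓝 0] fun z => Complex.exp z * φ z + (Complex.exp z - 1) * deriv φ z := by
    filter_upwards [huφ.eventuallyEq_nhds, hφa.eventually_analyticAt] with z hz hz'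
    rw [hz.deriv_eq]
    exact ((((Complex.hasDerivAt_exp z).sub_const 1).mul
      hz'.differentiableAt.hasDerivAt).const_add 1).deriv
  have hβ : deriv u 0 = complexVec p ⬝ᵥ (A.map Complex.ofReal *ᵥ 1) := by
    rw [hud'.self_of_nhds, ← hφ0]
    simp
  refine ⟨g, ?_, ?_, hβ, ?_⟩
  · have h1 : HasDerivAt (fun z => complexVec p ⬝ᵥ v z) (complexVec p ⬝ᵥ g) 0 := by
      simp only [dotProduct]
      exact HasDerivAt.fun_sum fun i _ => (hvd i).const_mul _
    have h2 : (fun z => complexVec p ⬝ᵥ v z) =ᶠ[𝓝 0] fun _ => 1 := by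
      filter_upwards [hev] with z hz using hz.1
    exact h1.unique ((hasDerivAt_const _ _).congr_of_eventuallyEq h2)
  -- The Poisson equation is the derivative at 0 of (A e^z + B) v = u v.
  · ext i
    have h1 : HasDerivAt (fun z => (expTwist A B z *ᵥ v z) i)
        ((A.map Complex.ofReal *ᵥ 1) i + ((A + B).map Complex.ofReal *ᵥ g) i) 0 := by
      simp only [mulVec, dotProduct]
      rw [← Finset.sum_add_distrib]
      refine HasDerivAt.fun_sum fun j _ => ?_
      have h2 : HasDerivAt (fun z => expTwist A B z i j) (A.map Complex.ofReal i j) 0 := by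
        simp only [expTwist, Matrix.add_apply, Matrix.smul_apply, smul_eq_mul]
        simpa using ((Complex.hasDerivAt_exp 0).mul_const (A.map Complex.ofReal i j)).add_const
          (B.map Complex.ofReal i j)
      have h3 := h2.mul (hvd j)
      rwa [expTwist_zero, hv0] at h3
    have h2 : (fun z => (expTwist A B z *ᵥ v z) i) =ᶠ[𝓝 0] fun z => u z * v z i := by
      filter_upwards [hev] with z hz
      rw [hz.2.1]
      rfl
    have h3 := h1.unique ((hud.mul (hvd i)).congr_of_eventuallyEq h2)
    rw [hv0, hu.2.1] at h3
    simpa using h3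
  · rw [iteratedDeriv_succ, iteratedDeriv_one, hud'.deriv_eq]
    have h1 := ((Complex.hasDerivAt_exp 0).mul hφa.differentiableAt.hasDerivAt).add
      (((Complex.hasDerivAt_exp 0).sub_const 1).mul hφa.deriv.differentiableAt.hasDerivAt)
    have h2 := h1.deriv
    simp only [Complex.exp_zero, one_mul, sub_self, zero_mul, add_zero] at h2
    rw [← hφ0, ← hφd]
    refine Eq.trans ?_ (h2.trans (by ring))
    rfl

end IsStochasticPair

theorem complexVec_dotProduct {m : ℕ} (x y : Fin m → ℝ) :
    complexVec x ⬝ᵥ complexVec y = ((x ⬝ᵥ y : ℝ) : ℂ) := by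
  simp [dotProduct, complexVec]

theorem map_ofReal_mulVec_complexVec {m : ℕ} (A : Matrix (Fin m) (Fin m) ℝ) (y : Fin m → ℝ) :
    A.map Complex.ofReal *ᵥ complexVec y = complexVec (A *ᵥ y) := by
  ext i
  simp [Matrix.mulVec, dotProduct, complexVec]

theorem complexVec_one {m : ℕ} : complexVec (1 : Fin m → ℝ) = 1 := by
  ext i
  simp [complexVec]

/-! ### Positivity of the mean and of the variance. -/

namespace IsStochasticPair

open Matrix

variable {m : ℕ} {A B : Matrix (Fin m) (Fin m) ℝ} {p : Fin m → ℝ} {u : ℂ → ℂ}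

/-- The asymptotic variance as a sum of squares. -/
theorem variance_eq_sum_sq (h : IsStochasticPair A B p) {g : Fin m → ℝ} {b : ℝ}
    (hg : p ⬝ᵥ g = 0) (hP : A *ᵥ 1 + (A + B) *ᵥ g = b • 1 + g) (hb : b = p ⬝ᵥ (A *ᵥ 1)) :
    b + 2 * (p ⬝ᵥ (A *ᵥ g)) - b ^ 2 =
      ∑ i, p i * ∑ j, (A i j * (1 - b + g j - g i) ^ 2 + B i j * (-b + g j - g i) ^ 2) := by
  -- By the Poisson equation, the increments [letter a] - b + g j - g i have mean zero from every
  -- state i, so they are martingale differences. Averaged over p, the squares of g cancel by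
  -- stationarity.
  have hrow : ∀ i, ∑ j, (A i j * (1 - b + g j - g i) ^ 2 + B i j * (-b + g j - g i) ^ 2) =
      ((A + B) *ᵥ fun j => g j ^ 2) i - (g i + b) ^ 2 + (A *ᵥ 1) i + 2 * (A *ᵥ g) i := by
    intro i
    have h1 : ((A + B) *ᵥ 1) i = 1 := by rw [h.mulVec_one]; rfl
    have h2 : (A *ᵥ 1) i + ((A + B) *ᵥ g) i = b + g i := by simpa using congrFun hP i
    have h3 : ∑ j, (A i j * (1 - b + g j - g i) ^ 2 + B i j * (-b + g j - g i) ^ 2) =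
        ((A + B) *ᵥ fun j => g j ^ 2) i - 2 * (g i + b) * ((A + B) *ᵥ g) i +
          (g i + b) ^ 2 * ((A + B) *ᵥ 1) i + (1 - 2 * g i - 2 * b) * (A *ᵥ 1) i +
          2 * (A *ᵥ g) i := by
      simp only [mulVec, dotProduct, Finset.mul_sum, ← Finset.sum_sub_distrib,
        ← Finset.sum_add_distrib, Matrix.add_apply, Pi.one_apply]
      exact Finset.sum_congr rfl fun j _ => by ring
    rw [h3, h1, show ((A + B) *ᵥ g) i = b + g i - (A *ᵥ 1) i by linarith]
    ring
  have hsum : ∑ i, p i = 1 := by simpa [dotProduct] using h.sum_eq_one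
  have hstat : ∑ i, p i * ((A + B) *ᵥ fun j => g j ^ 2) i = ∑ i, p i * g i ^ 2 := by
    change p ⬝ᵥ _ = p ⬝ᵥ fun j => g j ^ 2
    rw [dotProduct_mulVec, h.vecMul_eq]
  have hpg : ∑ i, p i * g i = 0 := hg
  calc b + 2 * (p ⬝ᵥ (A *ᵥ g)) - b ^ 2
      = ∑ i, p i * g i ^ 2 - (∑ i, p i * g i ^ 2 + 2 * b * ∑ i, p i * g i + b ^ 2 * ∑ i, p i) +
          p ⬝ᵥ (A *ᵥ 1) + 2 * (p ⬝ᵥ (A *ᵥ g)) := by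
        rw [hpg, hsum, ← hb]
        ring
    _ = ∑ i, p i * ((A + B) *ᵥ fun j => g j ^ 2) i -
          (∑ i, p i * g i ^ 2 + 2 * b * ∑ i, p i * g i + b ^ 2 * ∑ i, p i) +
          ∑ i, p i * (A *ᵥ 1) i + 2 * ∑ i, p i * (A *ᵥ g) i := by
        rw [hstat]
        rfl
    _ = _ := by
        simp only [hrow, Finset.mul_sum, ← Finset.sum_sub_distrib, ← Finset.sum_add_distrib]
        exact Finset.sum_congr rfl fun i _ => by ring

/-- The variance is a sum of non-negative terms. If it vanished, so would each term, and the
solution of the Poisson equation would be the potential excluded by `hpot`. -/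
theorem branch_mean_variance_pos (h : IsStochasticPair A B p) (hu : IsEigenvalueBranch A B 1 u)
    (hA : A ≠ 0)
    (hpot : ¬ ∃ (g : Fin m → ℝ) (b : ℝ), ∀ i j,
      (0 < A i j → g j - g i = b - 1) ∧ (0 < B i j → g j - g i = b)) :
    ∃ β γ : ℝ, (β : ℂ) = deriv u 0 ∧ (γ : ℂ) = iteratedDeriv 2 u 0 - deriv u 0 ^ 2 ∧
      0 < β ∧ 0 < γ := by
  obtain ⟨g, hpg, hg, hβ, hγ⟩ := h.branch_derivatives hu
  set b : ℝ := p ⬝ᵥ (A *ᵥ 1) with hb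
  have hβ' : deriv u 0 = b := by
    rw [hβ, ← complexVec_one, map_ofReal_mulVec_complexVec, complexVec_dotProduct]
  -- As b and the matrices are real, the imaginary part of g solves the homogeneous equation and is
  -- orthogonal to p.
  have him : (fun i => (g i).im) = 0 := by
    refine h.eq_zero_of_fixed (funext fun i => ?_) ?_
    · have := congrArg Complex.im (congrFun hg i)
      rw [hβ'] at this
      simpa [mulVec, dotProduct, -Complex.ofReal_add, -map_add, ← Complex.ofReal_add] using this
    · have := congrArg Complex.im hpg
      simpa [dotProduct, complexVec] using this
  obtain ⟨q, rfl⟩ : ∃ q : Fin m → ℝ, g = complexVec q :=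
    ⟨fun i => (g i).re, funext fun i => Complex.ext rfl (congrFun him i)⟩
  rw [complexVec_dotProduct] at hpg
  rw [hβ', ← complexVec_one, map_ofReal_mulVec_complexVec, map_ofReal_mulVec_complexVec] at hg
  rw [← complexVec_one, map_ofReal_mulVec_complexVec, map_ofReal_mulVec_complexVec,
    complexVec_dotProduct, complexVec_dotProduct, ← hb] at hγ
  have hpq : p ⬝ᵥ q = 0 := by exact_mod_cast hpg
  have hq : A *ᵥ 1 + (A + B) *ᵥ q = b • 1 + q := by
    ext i
    have := congrArg Complex.re (congrFun hg i)
    simpa [complexVec] using this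
  have hvar := h.variance_eq_sum_sq hpq hq hb
  have hterm : ∀ i j, 0 ≤ A i j * (1 - b + q j - q i) ^ 2 + B i j * (-b + q j - q i) ^ 2 :=
    fun i j => add_nonneg (mul_nonneg (h.nonneg_left i j) (sq_nonneg _))
      (mul_nonneg (h.nonneg_right i j) (sq_nonneg _))
  refine ⟨b, b + 2 * (p ⬝ᵥ (A *ᵥ q)) - b ^ 2, hβ'.symm, by rw [hγ, hβ']; push_cast; rfl, ?_, ?_⟩
  · obtain ⟨i, hi⟩ := Function.ne_iff.mp hA
    obtain ⟨j, hj⟩ := Function.ne_iff.mp hi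
    have hrow : ∀ i, 0 ≤ (A *ᵥ 1) i := fun i => by
      simpa [mulVec, dotProduct] using Finset.sum_nonneg fun j _ => h.nonneg_left i j
    refine Finset.sum_pos' (fun i _ => mul_nonneg (h.pos i).le (hrow i))
      ⟨i, Finset.mem_univ i, mul_pos (h.pos i) ?_⟩
    simpa [mulVec, dotProduct] using Finset.sum_pos' (fun j _ => h.nonneg_left i j)
      ⟨j, Finset.mem_univ j, lt_of_le_of_ne (h.nonneg_left i j) (Ne.symm hj)⟩
  · rw [hvar]
    have hnn : ∀ i, 0 ≤ p i *
        ∑ j, (A i j * (1 - b + q j - q i) ^ 2 + B i j * (-b + q j - q i) ^ 2) := fun i =>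
      mul_nonneg (h.pos i).le (Finset.sum_nonneg fun j _ => hterm i j)
    refine lt_of_le_of_ne (Finset.sum_nonneg fun i _ => hnn i) fun h0 => hpot ⟨q, b, ?_⟩
    intro i j
    have h1 := (Finset.sum_eq_zero_iff_of_nonneg fun i _ => hnn i).mp h0.symm i (Finset.mem_univ i)
    have h2 := (Finset.sum_eq_zero_iff_of_nonneg fun j _ => hterm i j).mp
      ((mul_eq_zero.mp h1).resolve_left (h.pos i).ne') j (Finset.mem_univ j)
    have h3 := (add_eq_zero_iff_of_nonneg (mul_nonneg (h.nonneg_left i j) (sq_nonneg _))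
      (mul_nonneg (h.nonneg_right i j) (sq_nonneg _))).mp h2
    refine ⟨fun hpos => ?_, fun hpos => ?_⟩
    · have := pow_eq_zero_iff (two_ne_zero) |>.mp ((mul_eq_zero.mp h3.1).resolve_left hpos.ne')
      linarith
    · have := pow_eq_zero_iff (two_ne_zero) |>.mp ((mul_eq_zero.mp h3.2).resolve_left hpos.ne')
      linarith

end IsStochasticPair

/-! ### Words, walks and aperiodicity. -/

theorem sum_vector_succ {α β : Type*} [Fintype α] [AddCommMonoid β] {n : ℕ}
    (f : List.Vector α (n + 1) → β) :
    ∑ w, f w = ∑ x : α, ∑ w : List.Vector α n, f (x ::ᵥ w) := by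
  rw [← Finset.sum_product']
  refine (Finset.sum_bij (fun (q : α × List.Vector α n) _ => q.1 ::ᵥ q.2)
    (fun _ _ => Finset.mem_univ _)
    (fun a _ b _ hab => ?_) (fun w _ => ?_) fun _ _ => rfl).symm
  · exact Prod.ext (congrArg List.Vector.head hab) (congrArg List.Vector.tail hab)
  · exact ⟨(w.head, w.tail), by simp, w.cons_head_tail⟩

/-- If a combination of unimodular numbers with non-negative coefficients has the largest possible
modulus, then the numbers with positive coefficient coincide. -/
theorem eq_of_norm_sum_eq {α : Type*} [Fintype α] {c : α → ℝ} {e : α → ℂ} (hc : ∀ w, 0 ≤ c w)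
    (he : ∀ w, ‖e w‖ = 1) (h : ∑ w, c w ≤ ‖∑ w, (c w : ℂ) * e w‖) {w₁ w₂ : α} (h₁ : 0 < c w₁)
    (h₂ : 0 < c w₂) : e w₁ = e w₂ := by
  classical
  by_contra hne
  have hw : w₁ ≠ w₂ := fun hw => hne (by rw [hw])
  have hnorm : ∀ w, ‖(c w : ℂ) * e w‖ = c w := fun w => by
    rw [norm_mul, he, mul_one, Complex.norm_real, Real.norm_of_nonneg (hc w)]
  -- Two terms with different phases lie on different rays, so the triangle inequality is strict for
  -- them; the other terms cannot make up the loss.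
  have hlt : ‖(c w₁ : ℂ) * e w₁ + (c w₂ : ℂ) * e w₂‖ < c w₁ + c w₂ := by
    have h3 : ¬ SameRay ℝ ((c w₁ : ℂ) * e w₁) ((c w₂ : ℂ) * e w₂) := fun hray => hne <| by
      have h4 := hray.norm_smul_eq
      rw [hnorm, hnorm, Complex.real_smul, Complex.real_smul, mul_left_comm] at h4
      have h5 : ∀ w, 0 < c w → (c w : ℂ) ≠ 0 := fun w hw => Complex.ofReal_ne_zero.mpr hw.ne'
      exact (mul_left_cancel₀ (h5 _ h₁) (mul_left_cancel₀ (h5 _ h₂) h4)).symm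
    exact (norm_add_lt_of_not_sameRay h3).trans_eq (by rw [hnorm, hnorm])
  have hsplit : ∀ {β : Type} [AddCommMonoid β] (f : α → β), ∑ w, f w =
      (f w₁ + f w₂) + ∑ w ∈ (Finset.univ.erase w₁).erase w₂, f w := fun f => by
    rw [← Finset.add_sum_erase _ f (Finset.mem_univ w₁), ← Finset.add_sum_erase _ f
      (Finset.mem_erase.mpr ⟨hw.symm, Finset.mem_univ w₂⟩), add_assoc]
  have h4 : ‖∑ w ∈ (Finset.univ.erase w₁).erase w₂, (c w : ℂ) * e w‖ ≤
      ∑ w ∈ (Finset.univ.erase w₁).erase w₂, c w :=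
    norm_sum_le_of_le _ fun w _ => (hnorm w).le
  rw [hsplit, hsplit] at h
  have h5 := norm_add_le ((c w₁ : ℂ) * e w₁ + (c w₂ : ℂ) * e w₂)
    (∑ w ∈ (Finset.univ.erase w₁).erase w₂, (c w : ℂ) * e w)
  linarith

namespace LinearRep

open Matrix

variable {m : ℕ} (R : LinearRep m)

theorem μ_cons (x : Letter) (l : List Letter) :
    R.μ (FreeMonoid.ofList (x :: l)) = R.letterMatrix x * R.μ (FreeMonoid.ofList l) := by
  rw [FreeMonoid.ofList_cons, map_mul]
  rfl

theorem μ_append (l l' : List Letter) :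
    R.μ (FreeMonoid.ofList (l ++ l')) =
      R.μ (FreeMonoid.ofList l) * R.μ (FreeMonoid.ofList l') := by
  rw [FreeMonoid.ofList_append, map_mul]

theorem expTwist_pow (z : ℂ) (n : ℕ) :
    expTwist R.A R.B z ^ n = ∑ w : List.Vector Letter n,
      Complex.exp (z * Y n w) • (R.μ (FreeMonoid.ofList w.toList)).map Complex.ofReal := by
  induction n with
  | zero =>
    rw [Fintype.sum_subsingleton _ List.Vector.nil]
    simp [Y]
  | succ n ih =>
    rw [sum_vector_succ, pow_succ', ih, expTwist, Finset.mul_sum]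
    have huniv : (Finset.univ : Finset Letter) = {Letter.a, Letter.b} := rfl
    rw [huniv, Finset.sum_pair (by decide), ← Finset.sum_add_distrib]
    refine Finset.sum_congr rfl fun w _ => ?_
    have hmul : ∀ X Z : Matrix (Fin m) (Fin m) ℝ,
        (X * Z).map Complex.ofReal = X.map Complex.ofReal * Z.map Complex.ofReal := fun X Z =>
      Matrix.map_mul (f := Complex.ofRealHom)
    simp only [List.Vector.toList_cons, μ_cons, hmul, letterMatrix, Y, List.count_cons]
    rw [add_mul, smul_mul_smul_comm, ← Complex.exp_add, mul_smul_comm]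
    congr 3
    simp
    ring

theorem add_pow_apply (n : ℕ) (i j : Fin m) :
    ((R.A + R.B) ^ n) i j =
      ∑ w : List.Vector Letter n, R.μ (FreeMonoid.ofList w.toList) i j := by
  have h := congrFun (congrFun (R.expTwist_pow 0 n) i) j
  have h1 : expTwist R.A R.B 0 = (R.A + R.B).map Complex.ofRealHom :=
    IsStochasticPair.expTwist_zero
  rw [h1, ← Matrix.map_pow, Matrix.sum_apply] at h
  simp only [zero_mul, Complex.exp_zero, one_smul] at h
  apply Complex.ofReal_injective
  rw [Complex.ofReal_sum]
  exact h

theorem μ_pos_of_walk {l : List Letter} {i j : Fin m} (h : R.Walk i l j) :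
    0 < R.μ (FreeMonoid.ofList l) i j := by
  induction l generalizing i with
  | nil =>
    cases (h : i = j)
    simp
  | cons x l ih =>
    obtain ⟨k, hk, hw⟩ := h
    rw [μ_cons, Matrix.mul_apply]
    exact Finset.sum_pos' (fun k _ => mul_nonneg (R.letterMatrix_nonneg _ _ _) (R.μ_nonneg _ _ _))
      ⟨k, Finset.mem_univ k, mul_pos hk (ih hw)⟩

theorem μ_append_pos {l l' : List Letter} {i j k : Fin m}
    (h : 0 < R.μ (FreeMonoid.ofList l) i j) (h' : 0 < R.μ (FreeMonoid.ofList l') j k) :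
    0 < R.μ (FreeMonoid.ofList (l ++ l')) i k := by
  rw [μ_append, Matrix.mul_apply]
  exact Finset.sum_pos' (fun k _ => mul_nonneg (R.μ_nonneg _ _ _) (R.μ_nonneg _ _ _))
    ⟨j, Finset.mem_univ j, mul_pos h h'⟩

/-- The integers x with e^{θx} = 1 form a subgroup aℤ. If it contained all cycle differences, a
would divide their gcd 1, so 1 would belong to it. -/
theorem exists_cycleDiff_exp_ne_one (hd : R.IsAperiodic) {θ : ℂ} (hθ : Complex.exp θ ≠ 1) :
    ∃ x ∈ R.cycleDiffs, Complex.exp (θ * x) ≠ 1 := by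
  by_contra! hall
  let H : AddSubgroup ℤ :=
    { carrier := {x | Complex.exp (θ * x) = 1}
      zero_mem' := by simp
      add_mem' := fun {a b} ha hb => by
        change Complex.exp _ = 1 at ha hb ⊢
        push_cast
        rw [mul_add, Complex.exp_add, ha, hb, one_mul]
      neg_mem' := fun {a} ha => by
        change Complex.exp _ = 1 at ha ⊢
        push_cast
        rw [mul_neg, Complex.exp_neg, ha, inv_one] }
  obtain ⟨a, ha⟩ := Int.subgroup_cyclic H
  have hmem : ∀ x, x ∈ H ↔ a ∣ x := fun x => by
    rw [ha, ← AddSubgroup.zmultiples_eq_closure, Int.mem_zmultiples_iff]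
  have h1 : a.natAbs ∣ 1 := hd.2 a.natAbs fun x hx => by
    rw [Int.natAbs_dvd, ← hmem]
    exact hall x hx
  have h2 : (1 : ℤ) ∈ H := by
    rw [hmem, ← Int.natAbs_dvd]
    exact_mod_cast h1
  change Complex.exp (θ * (1 : ℤ)) = 1 at h2
  exact hθ (by simpa using h2)

/-- Aperiodicity is incompatible with the existence of a potential along the edges. -/
theorem not_exists_potential (hd : R.IsAperiodic) :
    ¬ ∃ (g : Fin m → ℝ) (b : ℝ), ∀ i j,
      (0 < R.A i j → g j - g i = b - 1) ∧ (0 < R.B i j → g j - g i = b) := by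
  rintro ⟨g, b, hg⟩
  -- The potential telescopes along a walk. On a closed walk it leaves b · length = number of a's,
  -- so all cycle differences vanish and their gcd would be 0.
  have hwalk : ∀ (l : List Letter) (i j : Fin m), R.Walk i l j →
      g j - g i = b * l.length - l.count Letter.a := by
    intro l
    induction l with
    | nil =>
      rintro i j h
      cases (h : i = j)
      simp
    | cons x l ih =>
      rintro i j ⟨k, hk, hw⟩
      have h1 := ih k j hw
      cases x with
      | a =>
        have h2 := (hg i k).1 hk
        simp only [List.length_cons, List.count_cons_self]
        push_cast
        linarith
      | b =>
        have h2 := (hg i k).2 hk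
        rw [List.count_cons_of_ne (by decide)]
        simp only [List.length_cons]
        push_cast
        linarith
  have h0 := hd.2 0 fun x hx => by
    obtain ⟨w₁, w₂, ⟨-, i, h1⟩, ⟨-, j, h2⟩, hlen, rfl⟩ := hx
    have h3 := hwalk _ _ _ h1
    have h4 := hwalk _ _ _ h2
    rw [hlen] at h3
    have h5 : (w₁.count Letter.a : ℝ) = w₂.count Letter.a := by linarith
    rw [Nat.cast_zero, zero_dvd_iff, sub_eq_zero]
    exact_mod_cast h5
  simp at h0

open scoped Matrix.Norms.Operator

/-- For `θ ∉ 2πℤ`, some power of `A e^{iθ} + B` is a strict contraction. -/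
theorem exists_norm_expTwist_pow_lt_one {p : Fin m → ℝ} (h : IsStochasticPair R.A R.B p)
    (hd : R.IsAperiodic) {θ : ℝ} (hθ : Complex.exp (θ * Complex.I) ≠ 1) :
    ∃ K : ℕ, 0 < K ∧ ‖expTwist R.A R.B (θ * Complex.I) ^ K‖ < 1 := by
  obtain ⟨x, ⟨w₁, w₂, ⟨-, q₁, h1⟩, ⟨-, q₂, h2⟩, hlen, rfl⟩, hx⟩ :=
    R.exists_cycleDiff_exp_ne_one hd hθ
  obtain ⟨-, s, hs, hpos⟩ := h.isPrimitive
  have hpath : ∀ i j, ∃ w : List.Vector Letter s, 0 < R.μ (FreeMonoid.ofList w.toList) i j := by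
    intro i j
    have h3 := hpos i j
    rw [add_pow_apply] at h3
    obtain ⟨w, -, hw⟩ := Finset.exists_lt_of_sum_lt (s := Finset.univ)
      (f := fun _ : List.Vector Letter s => (0 : ℝ)) (by simpa using h3)
    exact ⟨w, hw⟩
  -- Length shared by two walks from i to q₂: i → q₁, the cycle w₁, then q₁ → q₂; and i → q₁ → q₂,
  -- then the cycle w₂. Their numbers of a's differ by the chosen cycle difference.
  set K := s + (w₁.length + s) with hK
  refine ⟨K, by omega, linfty_opNorm_lt_of_forall_sum_lt one_pos fun i => ?_⟩
  have happ : ∀ j, (expTwist R.A R.B (θ * Complex.I) ^ K) i j =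
      ∑ w : List.Vector Letter K, (R.μ (FreeMonoid.ofList w.toList) i j : ℂ) *
        Complex.exp (θ * Complex.I * Y K w) := fun j => by
    rw [expTwist_pow, Matrix.sum_apply]
    exact Finset.sum_congr rfl fun w _ => by
      rw [Matrix.smul_apply, Matrix.map_apply, smul_eq_mul, mul_comm]
  have hunit : ∀ w : List.Vector Letter K, ‖Complex.exp (θ * Complex.I * Y K w)‖ = 1 := fun w => by
    rw [show (θ * Complex.I * Y K w : ℂ) = ((θ * Y K w : ℝ) : ℂ) * Complex.I by push_cast; ring]
    exact Complex.norm_exp_ofReal_mul_I _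
  have hle : ∀ j, ‖(expTwist R.A R.B (θ * Complex.I) ^ K) i j‖ ≤ ((R.A + R.B) ^ K) i j :=
    fun j => by
      rw [happ, add_pow_apply]
      refine norm_sum_le_of_le _ fun w _ => ?_
      rw [norm_mul, hunit, mul_one, Complex.norm_real, Real.norm_of_nonneg (R.μ_nonneg _ _ _)]
  have hrow : ∑ j, ((R.A + R.B) ^ K) i j = 1 := by
    have hn : ∀ n : ℕ, ((R.A + R.B) ^ n) *ᵥ 1 = 1 := fun n => by
      induction n with
      | zero => simp
      | succ n ih => rw [pow_succ, ← mulVec_mulVec, h.mulVec_one, ih]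
    simpa [mulVec, dotProduct] using congrFun (hn K) i
  rw [← hrow]
  -- The row sum of moduli is at most 1; it suffices to lose in column q₂, where equality would
  -- force the two walks to have the same phase.
  refine Finset.sum_lt_sum (fun j _ => hle j) ⟨q₂, Finset.mem_univ _, ?_⟩
  refine lt_of_le_of_ne (hle q₂) fun heq => hx ?_
  obtain ⟨v₁, hv₁⟩ := hpath i q₁
  obtain ⟨v₂, hv₂⟩ := hpath q₁ q₂
  have hW₁ := R.μ_append_pos hv₁ (R.μ_append_pos (R.μ_pos_of_walk h1) hv₂)
  have hW₂ := R.μ_append_pos hv₁ (R.μ_append_pos hv₂ (R.μ_pos_of_walk h2))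
  set W₁ : List.Vector Letter K := ⟨v₁.toList ++ (w₁ ++ v₂.toList), by simp [hK]⟩ with hW₁def
  set W₂ : List.Vector Letter K := ⟨v₁.toList ++ (v₂.toList ++ w₂), by
    simp [hK, hlen, add_comm]⟩ with hW₂def
  rw [happ, add_pow_apply] at heq
  have hphase := eq_of_norm_sum_eq (c := fun w : List.Vector Letter K =>
    R.μ (FreeMonoid.ofList w.toList) i q₂) (fun w => R.μ_nonneg _ _ _) hunit heq.ge
    (w₁ := W₁) (w₂ := W₂) hW₁ hW₂
  have hY₁ : Y K W₁ =
      v₁.toList.count Letter.a + (w₁.count Letter.a + v₂.toList.count Letter.a) := by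
    simp [Y, hW₁def]
  have hY₂ : Y K W₂ =
      v₁.toList.count Letter.a + (v₂.toList.count Letter.a + w₂.count Letter.a) := by
    simp [Y, hW₂def]
  have hdiff : θ * Complex.I * ((w₁.count Letter.a - w₂.count Letter.a : ℤ) : ℂ) =
      θ * Complex.I * Y K W₁ - θ * Complex.I * Y K W₂ := by
    rw [hY₁, hY₂]
    push_cast
    ring
  rw [hdiff, Complex.exp_sub, hphase, div_self (Complex.exp_ne_zero _)]

/-- The powers of `A e^{iθ} + B` decay exponentially, uniformly for `θ ∈ [-π, π]` away from
`0`. -/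
theorem uniformPowDecay_expTwist {p : Fin m → ℝ} (h : IsStochasticPair R.A R.B p)
    (hd : R.IsAperiodic) {δ : ℝ} (hδ : 0 < δ) :
    UniformPowDecay (fun θ : ℝ => expTwist R.A R.B (θ * Complex.I))
      (Set.Icc (-Real.pi) Real.pi ∩ {θ | δ ≤ |θ|}) := by
  refine IsCompact.uniformPowDecay ?_ (fun θ _ => ?_) fun θ hθ => ?_
  · exact isCompact_Icc.inter_right (isClosed_le continuous_const continuous_abs)
  · exact ContinuousAt.comp (g := expTwist R.A R.B) (IsStochasticPair.continuousAt_expTwist _)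
      (by fun_prop)
  · refine R.exists_norm_expTwist_pow_lt_one h hd fun hexp => ?_
    obtain ⟨n, hn⟩ := Complex.exp_eq_one_iff.mp hexp
    have h1 : (θ : ℂ) = ((n * (2 * Real.pi) : ℝ) : ℂ) := by
      apply mul_right_cancel₀ Complex.I_ne_zero
      rw [hn]
      push_cast
      ring
    have h2 : θ = n * (2 * Real.pi) := by exact_mod_cast h1
    have hpi := Real.pi_pos
    have h3 : n = 0 := by
      have h4 : (n : ℝ) < 1 := by nlinarith [hθ.1.2]
      have h5 : (-1 : ℝ) < n := by nlinarith [hθ.1.1]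
      have h6 : n < 1 := by exact_mod_cast h4
      have h7 : -1 < n := by exact_mod_cast h5
      omega
    have h8 : δ ≤ |θ| := hθ.2
    rw [h2, h3] at h8
    simp at h8
    linarith

end LinearRep

/-! ### Gaussian approximation and Fourier integrals. -/

section Analysis

open Complex Filter MeasureTheory

/-- This is where γ gets its form: β and γ are the first two derivatives of log u, the cumulants per
letter. -/
theorem iteratedDeriv_two_log_comp {u : ℂ → ℂ} (hu : AnalyticAt ℂ u 0) (hu0 : u 0 = 1) :
    deriv (fun z => log (u z)) 0 = deriv u 0 ∧
      iteratedDeriv 2 (fun z => log (u z)) 0 = iteratedDeriv 2 u 0 - deriv u 0 ^ 2 := by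
  have hslit : ∀ᶠ z in 𝓝 (0 : ℂ), u z ∈ slitPlane :=
    hu.continuousAt.eventually_mem (isOpen_slitPlane.mem_nhds
      (by rw [hu0]; exact one_mem_slitPlane))
  have hd : deriv (fun z => log (u z)) =ᶠ[𝓝 0] fun z => deriv u z / u z := by
    filter_upwards [hslit, hu.eventually_analyticAt] with z hz hz'
    exact (hz'.differentiableAt.hasDerivAt.clog hz).deriv
  refine ⟨by rw [hd.self_of_nhds]; simp [hu0], ?_⟩
  rw [iteratedDeriv_succ, iteratedDeriv_one, hd.deriv_eq, iteratedDeriv_succ, iteratedDeriv_one]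
  have h1 := hu.deriv.differentiableAt.hasDerivAt.div hu.differentiableAt.hasDerivAt
    (by rw [hu0]; exact one_ne_zero)
  refine Eq.trans h1.deriv ?_
  rw [hu0]
  ring

/-- Second order expansion of the logarithm of `u` along the imaginary axis. -/
theorem exists_exp_expansion {u : ℂ → ℂ} (hu : AnalyticAt ℂ u 0) (hu0 : u 0 = 1) {β γ : ℝ}
    (hβ : (β : ℂ) = deriv u 0) (hγ : (γ : ℂ) = iteratedDeriv 2 u 0 - deriv u 0 ^ 2) :
    ∃ M : ℝ, 0 ≤ M ∧ ∀ᶠ θ : ℝ in 𝓝 0, ∃ ε : ℂ, ‖ε‖ ≤ M * |θ| ^ 3 ∧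
      u (θ * I) = cexp (β * θ * I - γ * θ ^ 2 / 2 + ε) := by
  have hla : AnalyticAt ℂ (fun z => log (u z)) 0 :=
    hu.clog (by rw [hu0]; exact one_mem_slitPlane)
  obtain ⟨F, hF, hexp⟩ := hla.exists_eventuallyEq_sum_add_pow_mul 3
  obtain ⟨hd1, hd2⟩ := iteratedDeriv_two_log_comp hu hu0
  have hne : ∀ᶠ z in 𝓝 (0 : ℂ), u z ≠ 0 :=
    hu.continuousAt.eventually_ne (by rw [hu0]; exact one_ne_zero)
  have hbd : ∀ᶠ z in 𝓝 (0 : ℂ), ‖F z‖ < ‖F 0‖ + 1 :=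
    hF.continuousAt.norm.eventually_lt continuousAt_const (by simp)
  have htend : Tendsto (fun θ : ℝ => (θ * I : ℂ)) (𝓝 0) (𝓝 0) := by
    have : Continuous fun θ : ℝ => (θ * I : ℂ) := by fun_prop
    simpa using this.tendsto 0
  refine ⟨‖F 0‖ + 1, by positivity, ?_⟩
  filter_upwards [htend.eventually (hexp.and (hne.and hbd))] with θ ⟨h1, h2, h3⟩
  refine ⟨(θ * I) ^ 3 * F (θ * I), ?_, ?_⟩
  · rw [norm_mul, norm_pow, norm_mul, norm_I, mul_one, norm_real, Real.norm_eq_abs, mul_comm]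
    gcongr
  · rw [← exp_log h2, h1, Finset.sum_range_succ, Finset.sum_range_succ, Finset.sum_range_one,
      iteratedDeriv_zero, iteratedDeriv_one, hd1, hd2, ← hγ, ← hβ, hu0, log_one]
    congr 1
    simp only [smul_eq_mul, mul_pow, I_sq]
    simp
    ring

theorem norm_exp_sub_one_le_mul_exp (w : ℂ) : ‖cexp w - 1‖ ≤ ‖w‖ * Real.exp ‖w‖ := by
  simpa using norm_exp_sub_sum_le_norm_mul_exp w 1

/-- A quasi-power is close to its Gaussian approximation. -/
theorem exists_quasi_power_bound {u r : ℂ → ℂ} (hu : AnalyticAt ℂ u 0) (hu0 : u 0 = 1)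
    (hr : AnalyticAt ℂ r 0) {β γ : ℝ} (hβ : (β : ℂ) = deriv u 0)
    (hγ : (γ : ℂ) = iteratedDeriv 2 u 0 - deriv u 0 ^ 2) (hγ0 : 0 < γ) :
    ∃ C : ℝ, 0 ≤ C ∧ ∀ᶠ θ : ℝ in 𝓝 0, ∀ n : ℕ,
      ‖u (θ * I) ^ n * r (θ * I) - r 0 * cexp (n * (β * θ * I - γ * θ ^ 2 / 2))‖ ≤
        C * (|θ| * Real.exp (-(γ / 8 * n * θ ^ 2))) := by
  obtain ⟨M, hM, hexp⟩ := exists_exp_expansion hu hu0 hβ hγ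
  obtain ⟨G, hG, hrG⟩ := hr.exists_eventuallyEq_sum_add_pow_mul 1
  have hbd : ∀ᶠ z in 𝓝 (0 : ℂ), ‖G z‖ < ‖G 0‖ + 1 :=
    hG.continuousAt.norm.eventually_lt continuousAt_const (by simp)
  have htend : Tendsto (fun θ : ℝ => (θ * I : ℂ)) (𝓝 0) (𝓝 0) := by
    have : Continuous fun θ : ℝ => (θ * I : ℂ) := by fun_prop
    simpa using this.tendsto 0
  -- So close to 0, the cubic error n ε is at most q / 4, half the Gaussian exponent q / 2 with q =
  -- γ n θ².
  have hsmall : ∀ᶠ θ : ℝ in 𝓝 0, M * |θ| < γ / 4 := by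
    have : ContinuousAt (fun θ : ℝ => M * |θ|) 0 := by fun_prop
    exact this.eventually_lt continuousAt_const (by simpa using hγ0)
  refine ⟨(‖G 0‖ + 1) + ‖r 0‖ * (8 * M / γ), by positivity, ?_⟩
  filter_upwards [hexp, htend.eventually (hrG.and hbd), hsmall] with θ ⟨ε, hε, hue⟩ ⟨h1, h2⟩ h3 n
  set q : ℝ := γ * n * θ ^ 2 with hq
  have hq0 : 0 ≤ q := by positivity
  have hnε : ‖n * ε‖ ≤ q / 4 := by
    rw [norm_mul, Complex.norm_natCast]
    calc (n : ℝ) * ‖ε‖ ≤ n * (M * |θ| ^ 3) := by gcongr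
      _ = n * ((M * |θ|) * θ ^ 2) := by rw [← sq_abs θ]; ring
      _ ≤ n * (γ / 4 * θ ^ 2) := by gcongr
      _ = q / 4 := by rw [hq]; ring
  have hgauss : ‖cexp (n * (β * θ * I - γ * θ ^ 2 / 2))‖ = Real.exp (-(q / 2)) := by
    rw [norm_exp]
    congr 1
    have : (n * (β * θ * I - γ * θ ^ 2 / 2) : ℂ) =
        ((n * (β * θ) : ℝ) : ℂ) * I + ((-(q / 2) : ℝ) : ℂ) := by
      rw [hq]
      push_cast
      ring
    rw [this, add_re, re_ofReal_mul, I_re, mul_zero, zero_add, ofReal_re]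
  have hun : u (θ * I) ^ n = cexp (n * (β * θ * I - γ * θ ^ 2 / 2)) * cexp (n * ε) := by
    rw [hue, ← exp_nat_mul, ← exp_add, mul_add]
  have hun_norm : ‖u (θ * I) ^ n‖ ≤ Real.exp (-(q / 8)) := by
    rw [hun, norm_mul, hgauss]
    calc Real.exp (-(q / 2)) * ‖cexp (n * ε)‖ ≤ Real.exp (-(q / 2)) * Real.exp (q / 4) := by
          gcongr
          rw [norm_exp]
          exact Real.exp_le_exp.mpr ((re_le_norm _).trans hnε)
      _ ≤ Real.exp (-(q / 8)) := by
          rw [← Real.exp_add]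
          exact Real.exp_le_exp.mpr (by linarith)
  have hr1 : ‖r (θ * I) - r 0‖ ≤ (‖G 0‖ + 1) * |θ| := by
    have h4 : r (θ * I) - r 0 = θ * I * G (θ * I) := by
      rw [h1]
      simp
    rw [h4, norm_mul, norm_mul, norm_I, mul_one, norm_real, Real.norm_eq_abs, mul_comm]
    gcongr
  -- The surviving factor e^{-q/4} is split into two factors e^{-q/8}. One absorbs nθ² from the
  -- error n|θ|³, at the price 8 / γ; the other remains in the bound.
  have hexp1 : q / 8 * Real.exp (-(q / 8)) ≤ 1 := by
    rw [Real.exp_neg, ← div_eq_mul_inv, div_le_one (Real.exp_pos _)]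
    linarith [Real.add_one_le_exp (q / 8)]
  have hdiff : ‖u (θ * I) ^ n - cexp (n * (β * θ * I - γ * θ ^ 2 / 2))‖ ≤
      8 * M / γ * (|θ| * Real.exp (-(q / 8))) := by
    have h4 : u (θ * I) ^ n - cexp (n * (β * θ * I - γ * θ ^ 2 / 2)) =
        cexp (n * (β * θ * I - γ * θ ^ 2 / 2)) * (cexp (n * ε) - 1) := by
      rw [hun]
      ring
    have hE : Real.exp (-(q / 2)) * Real.exp (q / 4) =
        Real.exp (-(q / 8)) * Real.exp (-(q / 8)) := by
      rw [← Real.exp_add, ← Real.exp_add]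
      congr 1
      ring
    rw [h4, norm_mul, hgauss]
    calc Real.exp (-(q / 2)) * ‖cexp (n * ε) - 1‖
        ≤ Real.exp (-(q / 2)) * (n * (M * |θ| ^ 3) * Real.exp (q / 4)) := by
          gcongr
          refine (norm_exp_sub_one_le_mul_exp _).trans ?_
          gcongr
          rw [norm_mul, Complex.norm_natCast]
          gcongr
      _ = 8 * M / γ * |θ| * (q / 8 * (Real.exp (-(q / 2)) * Real.exp (q / 4))) := by
          rw [hq, pow_succ |θ| 2, sq_abs]
          field_simp
      _ = 8 * M / γ * |θ| * (q / 8 * Real.exp (-(q / 8)) * Real.exp (-(q / 8))) := by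
          rw [hE]
          ring
      _ ≤ 8 * M / γ * |θ| * (1 * Real.exp (-(q / 8))) := by gcongr
      _ = _ := by ring
  have hq8 : γ / 8 * n * θ ^ 2 = q / 8 := by rw [hq]; ring
  rw [hq8]
  have hsplit : u (θ * I) ^ n * r (θ * I) - r 0 * cexp (n * (β * θ * I - γ * θ ^ 2 / 2)) =
      u (θ * I) ^ n * (r (θ * I) - r 0) +
        r 0 * (u (θ * I) ^ n - cexp (n * (β * θ * I - γ * θ ^ 2 / 2))) := by ring
  rw [hsplit]
  refine (norm_add_le _ _).trans ?_
  rw [norm_mul, norm_mul]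
  calc _ ≤ Real.exp (-(q / 8)) * ((‖G 0‖ + 1) * |θ|) +
        ‖r 0‖ * (8 * M / γ * (|θ| * Real.exp (-(q / 8)))) := by gcongr
    _ = _ := by ring

/-- Used with a proportional to n, this integral is the source of the O(1/n) error. -/
theorem integral_abs_mul_exp_neg_mul_sq {a : ℝ} (ha : 0 < a) :
    Integrable (fun θ : ℝ => |θ| * Real.exp (-(a * θ ^ 2))) ∧
      ∫ θ : ℝ, |θ| * Real.exp (-(a * θ ^ 2)) = a⁻¹ := by
  constructor
  · have h := (integrable_mul_exp_neg_mul_sq ha).norm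
    refine h.congr (Eventually.of_forall fun θ => ?_)
    simp
  · have h1 : ∫ θ : ℝ in Set.Ioi 0, θ * Real.exp (-(a * θ ^ 2)) = (2 * a)⁻¹ := by
      have h2 := integral_mul_cexp_neg_mul_sq (b := a) (by simpa using ha)
      apply ofReal_injective
      rw [← integral_complex_ofReal]
      push_cast
      rw [← h2]
      congr 1
      ext θ
      ring_nf
    have h3 := integral_comp_abs (f := fun θ : ℝ => θ * Real.exp (-(a * θ ^ 2)))
    simp only [sq_abs] at h3
    rw [h3, h1]
    field_simp

theorem pow_le_div_of_lt_one {ρ : ℝ} (h0 : 0 < ρ) (h1 : ρ < 1) {n : ℕ} (hn : 1 ≤ n) :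
    ρ ^ n ≤ (ρ⁻¹ - 1)⁻¹ / n := by
  have hx : 0 < ρ⁻¹ - 1 := sub_pos.mpr ((one_lt_inv₀ h0).mpr h1)
  have h2 := one_add_mul_le_pow (a := ρ⁻¹ - 1) (by linarith) n
  have hn' : (0 : ℝ) < n := by exact_mod_cast hn
  rw [add_sub_cancel, inv_pow] at h2
  rw [inv_eq_one_div, div_div, le_div_iff₀ (by positivity)]
  calc ρ ^ n * ((ρ⁻¹ - 1) * n) ≤ ρ ^ n * (ρ ^ n)⁻¹ := by
        gcongr
        linarith
    _ = 1 := mul_inv_cancel₀ (by positivity)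

theorem integral_gaussian_fourier {γ : ℝ} (hγ : 0 < γ) (β k : ℝ) {n : ℕ} (hn : 1 ≤ n) :
    Integrable (fun θ : ℝ => cexp (n * (β * θ * I - γ * θ ^ 2 / 2)) * cexp (-(k * θ * I))) ∧
      ∫ θ : ℝ, cexp (n * (β * θ * I - γ * θ ^ 2 / 2)) * cexp (-(k * θ * I)) =
        ((2 * Real.pi * (Real.exp (-(k - β * n) ^ 2 / (2 * γ * n)) /
          √(2 * Real.pi * γ * n)) : ℝ) : ℂ) := by
  have hn' : (0 : ℝ) < n := by exact_mod_cast hn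
  have hb : (((-(n * γ / 2) : ℝ) : ℂ)).re < 0 := by
    rw [ofReal_re]
    have : 0 < n * γ / 2 := by positivity
    linarith
  have heq : (fun θ : ℝ => cexp (n * (β * θ * I - γ * θ ^ 2 / 2)) * cexp (-(k * θ * I))) =
      fun θ : ℝ => cexp (((-(n * γ / 2) : ℝ) : ℂ) * θ ^ 2 + ((n * β - k : ℝ) : ℂ) * I * θ + 0) := by
    ext θ
    rw [← exp_add]
    congr 1
    push_cast
    ring
  rw [heq]
  refine ⟨integrable_cexp_quadratic' hb _ _, ?_⟩
  rw [integral_cexp_quadratic hb]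
  have h1 : (0 - (((n * β - k : ℝ) : ℂ) * I) ^ 2 / (4 * ((-(n * γ / 2) : ℝ) : ℂ))) =
      ((-(k - β * n) ^ 2 / (2 * γ * n) : ℝ) : ℂ) := by
    have hγc : (γ : ℂ) ≠ 0 := ofReal_ne_zero.mpr hγ.ne'
    have hnc : (n : ℂ) ≠ 0 := Nat.cast_ne_zero.mpr (by omega)
    rw [mul_pow, I_sq]
    push_cast
    field_simp
    ring
  have h2 : ((Real.pi : ℂ) / -((-(n * γ / 2) : ℝ) : ℂ)) ^ (1 / 2 : ℂ) =
      ((2 * Real.pi / √(2 * Real.pi * γ * n) : ℝ) : ℂ) := by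
    have h3 : (Real.pi : ℂ) / -((-(n * γ / 2) : ℝ) : ℂ) = ((Real.pi / (n * γ / 2) : ℝ) : ℂ) := by
      push_cast
      ring
    have h4 : (1 / 2 : ℂ) = ((1 / 2 : ℝ) : ℂ) := by push_cast; rfl
    rw [h3, h4, ← ofReal_cpow (by positivity), ← Real.sqrt_eq_rpow]
    congr 1
    rw [eq_div_iff (by positivity), ← Real.sqrt_mul (by positivity),
      Real.sqrt_eq_iff_mul_self_eq (by positivity) (by positivity)]
    field_simp
  rw [h1, h2, ← ofReal_exp, ← ofReal_mul]
  congr 1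
  ring

theorem norm_cexp_neg_mul_I (k θ : ℝ) : ‖cexp (-(k * θ * I))‖ = 1 := by
  rw [show (-(k * θ * I) : ℂ) = ((-(k * θ) : ℝ) : ℂ) * I by push_cast; ring]
  exact norm_exp_ofReal_mul_I _

theorem norm_cexp_gaussian (β γ θ : ℝ) (n : ℕ) :
    ‖cexp (n * (β * θ * I - γ * θ ^ 2 / 2))‖ = Real.exp (-(γ * n * θ ^ 2 / 2)) := by
  rw [norm_exp]
  congr 1
  rw [show (n * (β * θ * I - γ * θ ^ 2 / 2) : ℂ) =
    ((n * (β * θ) : ℝ) : ℂ) * I + ((-(γ * n * θ ^ 2 / 2) : ℝ) : ℂ) by push_cast; ring]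
  rw [add_re, re_ofReal_mul, I_re, mul_zero, zero_add, ofReal_re]

/-- If `f` is pointwise close to a Gaussian characteristic function, then its Fourier coefficients
are close to the Gaussian density. -/
theorem exists_fourier_bound {f : ℕ → ℝ → ℂ} (hf : ∀ n, Continuous (f n)) {c β γ b ρ C : ℝ}
    (hγ : 0 < γ) (hb : 0 < b) (hbγ : b ≤ γ / 2) (hρ0 : 0 < ρ) (hρ1 : ρ < 1)
    (hC : 0 ≤ C)
    (hbound : ∀ n : ℕ, 1 ≤ n → ∀ θ ∈ Set.Icc (-Real.pi) Real.pi,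
      ‖f n θ - c * cexp (n * (β * θ * I - γ * θ ^ 2 / 2))‖ ≤
        C * (ρ ^ n + |θ| * Real.exp (-(b * n * θ ^ 2)))) :
    ∃ D : ℝ, ∀ n : ℕ, 1 ≤ n → ∀ k : ℝ,
      ‖(∫ θ in (-Real.pi)..Real.pi, f n θ * cexp (-(k * θ * I))) -
        c * ((2 * Real.pi * (Real.exp (-(k - β * n) ^ 2 / (2 * γ * n)) /
          √(2 * Real.pi * γ * n)) : ℝ) : ℂ)‖ ≤ D / n := by
  -- C bounds the error on [-π, π], |c| the Gaussian tail outside. The two summands come from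
  -- integrating ρ ^ n over [-π, π] and |θ| e^{-bnθ²} over ℝ.
  refine ⟨(C + |c|) * (2 * Real.pi * (ρ⁻¹ - 1)⁻¹ + b⁻¹), fun n hn k => ?_⟩
  have hpi := Real.pi_pos
  have hn' : (0 : ℝ) < n := by exact_mod_cast hn
  obtain ⟨hgint, hg⟩ := integral_gaussian_fourier hγ β k hn
  have hbn : 0 < b * n := by positivity
  obtain ⟨haint, ha⟩ := integral_abs_mul_exp_neg_mul_sq hbn
  have hfc : Continuous fun θ : ℝ => f n θ * cexp (-(k * θ * I)) := (hf n).mul (by fun_prop)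
  have hfint : Integrable ((Set.Ioc (-Real.pi) Real.pi).indicator
      fun θ : ℝ => f n θ * cexp (-(k * θ * I))) :=
    (integrable_indicator_iff measurableSet_Ioc).mpr
      ((hfc.integrableOn_Icc).mono_set Set.Ioc_subset_Icc_self)
  have hrint : Integrable ((Set.Ioc (-Real.pi) Real.pi).indicator fun _ : ℝ => ρ ^ n) :=
    (integrable_indicator_iff measurableSet_Ioc).mpr
      ((continuous_const.integrableOn_Icc).mono_set Set.Ioc_subset_Icc_self)
  rw [intervalIntegral.integral_of_le (by linarith), ← integral_indicator measurableSet_Ioc, ← hg,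
    ← integral_const_mul, ← integral_sub hfint (hgint.const_mul _)]
  have hpt : ∀ θ : ℝ, ‖(Set.Ioc (-Real.pi) Real.pi).indicator
        (fun θ : ℝ => f n θ * cexp (-(k * θ * I))) θ -
        c * (cexp (n * (β * θ * I - γ * θ ^ 2 / 2)) * cexp (-(k * θ * I)))‖ ≤
      (C + |c|) * ((Set.Ioc (-Real.pi) Real.pi).indicator (fun _ : ℝ => ρ ^ n) θ +
        |θ| * Real.exp (-(b * n * θ ^ 2))) := by
    intro θ
    by_cases hθ : θ ∈ Set.Ioc (-Real.pi) Real.pi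
    · rw [Set.indicator_of_mem hθ, Set.indicator_of_mem hθ, ← mul_assoc, ← sub_mul, norm_mul,
        norm_cexp_neg_mul_I, mul_one]
      refine (hbound n hn θ (Set.Ioc_subset_Icc_self hθ)).trans ?_
      gcongr
      exact le_add_of_nonneg_right (abs_nonneg c)
    · rw [Set.indicator_of_notMem hθ, Set.indicator_of_notMem hθ, zero_sub, norm_neg, norm_mul,
        norm_mul, norm_cexp_neg_mul_I, mul_one, norm_cexp_gaussian, norm_real, Real.norm_eq_abs,
        zero_add]
      -- In the tail the missing factor |θ| may be inserted for free.
      have h1 : 1 ≤ |θ| := by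
        by_contra! hlt
        rw [abs_lt] at hlt
        have := Real.pi_gt_three
        exact hθ ⟨by linarith, by linarith⟩
      have h2 : Real.exp (-(γ * n * θ ^ 2 / 2)) ≤ Real.exp (-(b * n * θ ^ 2)) := by
        apply Real.exp_le_exp.mpr
        have : b * (n * θ ^ 2) ≤ γ / 2 * (n * θ ^ 2) := by gcongr
        linarith
      calc |c| * Real.exp (-(γ * n * θ ^ 2 / 2))
          ≤ (C + |c|) * (1 * Real.exp (-(b * n * θ ^ 2))) := by
            rw [one_mul]
            gcongr
            exact le_add_of_nonneg_left hC
        _ ≤ _ := by gcongr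
  refine (norm_integral_le_of_norm_le ((hrint.add haint).const_mul _)
    (Eventually.of_forall hpt)).trans ?_
  simp only [Pi.add_apply]
  rw [integral_const_mul, integral_add hrint haint, ha, integral_indicator measurableSet_Ioc,
    setIntegral_const, smul_eq_mul, Real.volume_real_Ioc_of_le (by linarith), mul_div_assoc]
  gcongr
  calc (Real.pi - -Real.pi) * ρ ^ n + (b * n)⁻¹
      ≤ (Real.pi - -Real.pi) * ((ρ⁻¹ - 1)⁻¹ / n) + (b * n)⁻¹ := by
        gcongr
        · linarith
        · exact pow_le_div_of_lt_one hρ0 hρ1 hn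
    _ = _ := by
        rw [mul_inv]
        ring

end Analysis

theorem integral_cexp_int_mul_I (d : ℤ) :
    ∫ θ in (-Real.pi)..Real.pi, Complex.exp (d * θ * Complex.I) =
      if d = 0 then (2 * Real.pi : ℂ) else 0 := by
  split_ifs with hd
  · subst hd
    simp
    ring
  · have hc : (d * Complex.I : ℂ) ≠ 0 := mul_ne_zero (Int.cast_ne_zero.mpr hd) Complex.I_ne_zero
    have h1 : ∀ θ : ℝ, (d * θ * Complex.I : ℂ) = d * Complex.I * θ := fun θ => by ring
    simp only [h1]
    rw [integral_exp_mul_complex hc, div_eq_zero_iff, sub_eq_zero]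
    left
    rw [Complex.exp_eq_exp_iff_exists_int]
    refine ⟨d, ?_⟩
    push_cast
    ring

/-! ### The local limit theorem for stochastic A + B. -/

namespace LinearRep

open Matrix Filter
open scoped Matrix.Norms.Operator

variable {m : ℕ} (R : LinearRep m)

/-- The unnormalised characteristic function of `Y n`. -/
theorem dotProduct_expTwist_pow (z : ℂ) (n : ℕ) :
    complexVec R.ξ ⬝ᵥ (expTwist R.A R.B z ^ n *ᵥ complexVec R.η) =
      ∑ w : List.Vector Letter n, (R.weight w : ℂ) * Complex.exp (z * Y n w) := by
  rw [expTwist_pow, Matrix.sum_mulVec, dotProduct_sum]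
  refine Finset.sum_congr rfl fun w _ => ?_
  rw [smul_mulVec, dotProduct_smul, map_ofReal_mulVec_complexVec, complexVec_dotProduct,
    smul_eq_mul, mul_comm]
  rfl

/-- Orthogonality of the characters e^{idθ} on [-π, π] isolates the words with Y = k. -/
theorem integral_charFun (n k : ℕ) :
    ∫ θ in (-Real.pi)..Real.pi,
      (complexVec R.ξ ⬝ᵥ (expTwist R.A R.B (θ * Complex.I) ^ n *ᵥ complexVec R.η)) *
        Complex.exp (-((k : ℝ) * θ * Complex.I)) =
      ((2 * Real.pi * ∑ w : List.Vector Letter n with Y n w = k, R.weight w : ℝ) : ℂ) := by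
  have h1 : ∀ θ : ℝ,
      (complexVec R.ξ ⬝ᵥ (expTwist R.A R.B (θ * Complex.I) ^ n *ᵥ complexVec R.η)) *
        Complex.exp (-((k : ℝ) * θ * Complex.I)) =
      ∑ w : List.Vector Letter n, (R.weight w : ℂ) *
        Complex.exp (((Y n w - k : ℤ) : ℂ) * θ * Complex.I) := fun θ => by
    rw [dotProduct_expTwist_pow, Finset.sum_mul]
    refine Finset.sum_congr rfl fun w _ => ?_
    rw [mul_assoc, ← Complex.exp_add]
    congr 2
    push_cast
    ring
  simp only [h1]
  rw [intervalIntegral.integral_finsetSum fun w _ =>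
    Continuous.intervalIntegrable (by fun_prop) _ _]
  simp only [intervalIntegral.integral_const_mul, integral_cexp_int_mul_I]
  rw [Finset.sum_filter, Finset.mul_sum, Complex.ofReal_sum]
  refine Finset.sum_congr rfl fun w _ => ?_
  have h2 : ((Y n w : ℤ) - k = 0) ↔ Y n w = k := by omega
  simp only [h2]
  split_ifs
  · push_cast
    ring
  · simp

theorem dotProduct_pos_of_hasPositiveWords (hR : R.HasPositiveWords) {p : Fin m → ℝ}
    (hp : ∀ i, 0 < p i) : 0 < R.ξ ⬝ᵥ 1 ∧ 0 < p ⬝ᵥ R.η := by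
  obtain ⟨w, hw⟩ := hR 1 le_rfl
  have hξ : R.ξ ≠ 0 := by
    intro h
    simp [weight, series, h] at hw
  have hη : R.η ≠ 0 := by
    intro h
    simp [weight, series, h] at hw
  obtain ⟨i, hi⟩ := Function.ne_iff.mp hξ
  obtain ⟨j, hj⟩ := Function.ne_iff.mp hη
  constructor
  · simpa [dotProduct] using Finset.sum_pos' (fun i _ => R.ξ_nonneg i)
      ⟨i, Finset.mem_univ i, lt_of_le_of_ne (R.ξ_nonneg i) (Ne.symm hi)⟩
  · exact Finset.sum_pos' (fun i _ => mul_nonneg (hp i).le (R.η_nonneg i))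
      ⟨j, Finset.mem_univ j, mul_pos (hp j) (lt_of_le_of_ne (R.η_nonneg j) (Ne.symm hj))⟩

/-- On `[-π, π]` the characteristic function is uniformly close to a Gaussian one. -/
theorem exists_charFun_bound {p : Fin m → ℝ} (h : IsStochasticPair R.A R.B p)
    (hd : R.IsAperiodic) {u : ℂ → ℂ} (hu : IsEigenvalueBranch R.A R.B 1 u) {β γ : ℝ}
    (hβ : (β : ℂ) = deriv u 0) (hγ : (γ : ℂ) = iteratedDeriv 2 u 0 - deriv u 0 ^ 2)
    (hγ0 : 0 < γ) :
    ∃ ρ C : ℝ, 0 < ρ ∧ ρ < 1 ∧ 0 ≤ C ∧ ∀ n : ℕ, 1 ≤ n →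
      ∀ θ ∈ Set.Icc (-Real.pi) Real.pi,
      ‖complexVec R.ξ ⬝ᵥ (expTwist R.A R.B (θ * Complex.I) ^ n *ᵥ complexVec R.η) -
        (((R.ξ ⬝ᵥ 1) * (p ⬝ᵥ R.η) : ℝ) : ℂ) *
          Complex.exp (n * (β * θ * Complex.I - γ * θ ^ 2 / 2))‖ ≤
        C * (ρ ^ n + |θ| * Real.exp (-(γ / 8 * n * θ ^ 2))) := by
  obtain ⟨r, hra, hr0, ρ₁, hρ₁, hρ₁', C₁, hC₁, hqp⟩ :=
    h.quasi_power hu (complexVec R.ξ) (complexVec R.η)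
  rw [← complexVec_one, complexVec_dotProduct, complexVec_dotProduct, ← Complex.ofReal_mul] at hr0
  set c : ℝ := (R.ξ ⬝ᵥ 1) * (p ⬝ᵥ R.η)
  have hu0 : u 0 = 1 := by rw [hu.2.1, Complex.ofReal_one]
  obtain ⟨C₂, hC₂, hgauss⟩ := exists_quasi_power_bound hu.1 hu0 hra hβ hγ hγ0
  rw [hr0] at hgauss
  have htend : Tendsto (fun θ : ℝ => (θ * Complex.I : ℂ)) (𝓝 0) (𝓝 0) := by
    have : Continuous fun θ : ℝ => (θ * Complex.I : ℂ) := by fun_prop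
    simpa using this.tendsto 0
  obtain ⟨δ, hδ, hnear⟩ := Metric.eventually_nhds_iff.mp ((htend.eventually hqp).and hgauss)
  obtain ⟨ρ₂, hρ₂, hρ₂', C₃, hC₃, hfar⟩ := R.uniformPowDecay_expTwist h hd hδ
  set S := (∑ i, ‖complexVec R.ξ i‖) * (∑ j, ‖complexVec R.η j‖)
  have hS : 0 ≤ S := by positivity
  refine ⟨max ρ₁ ρ₂, C₁ + C₂ + S * C₃ + |c| / δ, lt_max_of_lt_left hρ₁, max_lt hρ₁' hρ₂',
    by positivity, fun n hn θ hθ => ?_⟩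
  set e := |θ| * Real.exp (-(γ / 8 * n * θ ^ 2)) with he
  have he0 : 0 ≤ e := by positivity
  have hm1 : ρ₁ ^ n ≤ max ρ₁ ρ₂ ^ n := by gcongr; exact le_max_left _ _
  have hm2 : ρ₂ ^ n ≤ max ρ₁ ρ₂ ^ n := by gcongr; exact le_max_right _ _
  have hm0 : 0 ≤ max ρ₁ ρ₂ ^ n := le_trans (by positivity) hm1
  have hcδ : 0 ≤ |c| / δ := by positivity
  have hSC : 0 ≤ S * C₃ := by positivity
  have hnonneg := add_nonneg hm0 he0
  rcases lt_or_ge |θ| δ with hlt | hge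
  · obtain ⟨h1, h2⟩ := hnear (y := θ) (by simpa using hlt)
    have h3 := norm_add_le_of_le (h1 n hn) (h2 n)
    rw [sub_add_sub_cancel] at h3
    calc _ ≤ C₁ * ρ₁ ^ n + C₂ * e := h3
      _ ≤ C₁ * (max ρ₁ ρ₂ ^ n + e) + C₂ * (max ρ₁ ρ₂ ^ n + e) := by
          gcongr
          · linarith
          · linarith
      _ ≤ _ := by
          have := mul_nonneg hSC hnonneg
          have := mul_nonneg hcδ hnonneg
          linarith
  · have h1 : ‖complexVec R.ξ ⬝ᵥ (expTwist R.A R.B (θ * Complex.I) ^ n *ᵥ complexVec R.η)‖ ≤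
        S * (C₃ * ρ₂ ^ n) :=
      (norm_dotProduct_mulVec_le _ _ _).trans (by gcongr; exact hfar θ ⟨hθ, hge⟩ n)
    -- Away from 0 both terms are small separately; 1 ≤ |θ| / δ supplies the factor |θ| in the
    -- Gaussian one.
    have h2 : ‖(c : ℂ) * Complex.exp (n * (β * θ * Complex.I - γ * θ ^ 2 / 2))‖ ≤
        |c| / δ * e := by
      rw [norm_mul, norm_cexp_gaussian, Complex.norm_real, Real.norm_eq_abs, div_mul_eq_mul_div,
        le_div_iff₀ hδ, mul_assoc, mul_comm _ δ]
      gcongr |c| * ?_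
      rw [he]
      gcongr
      nlinarith [(by positivity : 0 ≤ γ * n * θ ^ 2)]
    refine (norm_sub_le_of_le h1 h2).trans ?_
    calc S * (C₃ * ρ₂ ^ n) + |c| / δ * e
        ≤ S * C₃ * (max ρ₁ ρ₂ ^ n + e) + |c| / δ * (max ρ₁ ρ₂ ^ n + e) := by
          rw [← mul_assoc]
          gcongr
          · linarith
          · linarith
      _ ≤ _ := by
          have := mul_nonneg hC₁ hnonneg
          have := mul_nonneg hC₂ hnonneg
          linarith

/-- The local limit theorem when `A + B` is a stochastic matrix. -/
theorem local_limit_of_isStochasticPair (hR : R.HasPositiveWords) {p : Fin m → ℝ}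
    (h : IsStochasticPair R.A R.B p)
    (hd : R.IsAperiodic) {u : ℂ → ℂ} (hu : IsEigenvalueBranch R.A R.B 1 u) {β γ : ℝ}
    (hβ : (β : ℂ) = deriv u 0) (hγ : (γ : ℂ) = iteratedDeriv 2 u 0 - deriv u 0 ^ 2)
    (hγ0 : 0 < γ) :
    ∃ C : ℝ, ∀ n : ℕ, 1 ≤ n → ∀ k : ℕ,
      |√(n : ℝ) * R.probY n k -
          Real.exp (-((k : ℝ) - β * n) ^ 2 / (2 * γ * n)) / √(2 * Real.pi * γ)|
        ≤ C * (n : ℝ) ^ (-(1 / 2) : ℝ) := by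
  obtain ⟨ρ, C, hρ0, hρ1, hC, hbound⟩ := R.exists_charFun_bound h hd hu hβ hγ hγ0
  obtain ⟨hξ, hη⟩ := R.dotProduct_pos_of_hasPositiveWords hR h.pos
  set c : ℝ := (R.ξ ⬝ᵥ 1) * (p ⬝ᵥ R.η)
  have hc : 0 < c := mul_pos hξ hη
  have hcont : ∀ n : ℕ, Continuous fun θ : ℝ =>
      complexVec R.ξ ⬝ᵥ (expTwist R.A R.B (θ * Complex.I) ^ n *ᵥ complexVec R.η) := fun n => by
    simp only [dotProduct_expTwist_pow]
    fun_prop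
  obtain ⟨D, hD⟩ := exists_fourier_bound hcont hγ0 (by positivity : 0 < γ / 8) (by linarith)
    hρ0 hρ1 hC hbound
  have hpi := Real.pi_pos
  refine ⟨(D / (2 * Real.pi) + C * (ρ⁻¹ - 1)⁻¹) / c, fun n hn k => ?_⟩
  have hn' : (0 : ℝ) < n := by exact_mod_cast hn
  set S := ∑ w : List.Vector Letter n, R.weight w with hSdef
  set N := ∑ w : List.Vector Letter n with Y n w = k, R.weight w with hNdef
  set g := Real.exp (-((k : ℝ) - β * n) ^ 2 / (2 * γ * n)) / √(2 * Real.pi * γ * n) with hg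
  have hS0 : 0 < S := by
    obtain ⟨w, hw⟩ := hR n hn
    exact Finset.sum_pos' (fun x _ => R.weight_nonneg x) ⟨w, Finset.mem_univ w, hw⟩
  have hprob : R.probY n k = N / S := by
    simp only [probY, wordProb, ← Finset.sum_div, hNdef, hSdef]
  have hN0 : 0 ≤ N := Finset.sum_nonneg fun w _ => R.weight_nonneg w
  have hNS : N ≤ S := Finset.sum_le_sum_of_subset_of_nonneg (Finset.filter_subset _ _)
    fun w _ _ => R.weight_nonneg w
  have hprob0 : 0 ≤ R.probY n k := by rw [hprob]; positivity
  have hprob1 : R.probY n k ≤ 1 := by rw [hprob]; exact div_le_one_of_le₀ hNS hS0.le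
  -- At θ = 0 the characteristic function is the total weight and the Gaussian error vanishes.
  have hSc : |S - c| ≤ C * ρ ^ n := by
    have h1 := hbound n hn 0 ⟨by linarith, hpi.le⟩
    rw [dotProduct_expTwist_pow] at h1
    simp only [Complex.ofReal_zero, zero_mul, Complex.exp_zero, mul_one, mul_zero, ne_eq,
      OfNat.ofNat_ne_zero, not_false_eq_true, zero_pow, zero_div, sub_zero, abs_zero,
      add_zero] at h1
    rw [← Complex.ofReal_sum, ← Complex.ofReal_sub, Complex.norm_real, Real.norm_eq_abs] at h1
    exact h1
  have hNg : |N - c * g| ≤ D / (2 * Real.pi) / n := by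
    have h1 := hD n hn k
    rw [R.integral_charFun n k, ← Complex.ofReal_mul, ← Complex.ofReal_sub, Complex.norm_real,
      Real.norm_eq_abs, ← mul_assoc c, mul_comm c, mul_assoc (2 * Real.pi), ← mul_sub, abs_mul,
      abs_of_pos (by positivity : 0 < 2 * Real.pi)] at h1
    rw [div_right_comm, le_div_iff₀ (by positivity), mul_comm]
    exact h1
  have hmain : |R.probY n k - g| ≤ (D / (2 * Real.pi) + C * (ρ⁻¹ - 1)⁻¹) / c / n := by
    -- Separates the error of the numerator from that of the normalising sum, which is harmless as
    -- probabilities are at most 1.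
    have h1 : c * (R.probY n k - g) = (N - c * g) - R.probY n k * (S - c) := by
      rw [hprob]
      field_simp
      ring
    have h2 : c * |R.probY n k - g| ≤ (D / (2 * Real.pi) + C * (ρ⁻¹ - 1)⁻¹) / n := by
      rw [← abs_of_pos hc, ← abs_mul, h1]
      refine (abs_sub _ _).trans ?_
      rw [abs_mul, abs_of_nonneg hprob0]
      calc |N - c * g| + R.probY n k * |S - c|
          ≤ D / (2 * Real.pi) / n + 1 * (C * ((ρ⁻¹ - 1)⁻¹ / n)) := by
            gcongr
            exact hSc.trans (by gcongr; exact pow_le_div_of_lt_one hρ0 hρ1 hn)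
        _ = _ := by ring
    rw [div_right_comm, le_div_iff₀ hc, mul_comm]
    exact h2
  have hsq : √(n : ℝ) * g =
      Real.exp (-((k : ℝ) - β * n) ^ 2 / (2 * γ * n)) / √(2 * Real.pi * γ) := by
    rw [hg, Real.sqrt_mul (by positivity)]
    field_simp
  have hrpow : (n : ℝ) ^ (-(1 / 2) : ℝ) = √(n : ℝ) / n := by
    rw [Real.rpow_neg hn'.le, ← Real.sqrt_eq_rpow, eq_div_iff hn'.ne', inv_mul_eq_div,
      Real.div_sqrt]
  rw [← hsq, ← mul_sub, abs_mul, abs_of_nonneg (Real.sqrt_nonneg _), hrpow]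
  calc √(n : ℝ) * |R.probY n k - g|
      ≤ √(n : ℝ) * ((D / (2 * Real.pi) + C * (ρ⁻¹ - 1)⁻¹) / c / n) := by gcongr
    _ = _ := by ring

end LinearRep

/-- As p is a left fixed vector and c ≠ 1, y is orthogonal to p. It is then an eigenvector of A + B
- 1p' for the same c, and a power of that matrix is a strict contraction. -/
theorem IsStochasticPair.norm_lt_one_of_eigenvector {m : ℕ} {A B : Matrix (Fin m) (Fin m) ℝ}
    {p : Fin m → ℝ} (h : IsStochasticPair A B p) {y : Fin m → ℂ} {c : ℂ}
    (hy : (A + B).map Complex.ofReal *ᵥ y = c • y) (hy0 : y ≠ 0) (hc : c ≠ 1) : ‖c‖ < 1 := by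
  open scoped Matrix.Norms.Operator in
  have := h.nonempty
  obtain ⟨K, hK, hlt⟩ := h.isPrimitive.exists_norm_pow_sub_lt_one h.mulVec_one h.vecMul_eq h.pos
    h.sum_eq_one
  set N : Matrix (Fin m) (Fin m) ℂ := (A + B - Matrix.vecMulVec 1 p).map Complex.ofRealHom with hN
  have hpy : complexVec p ⬝ᵥ y = 0 := by
    have h1 := congrArg (complexVec p ⬝ᵥ ·) hy
    simp only [Matrix.dotProduct_mulVec, dotProduct_smul, smul_eq_mul] at h1
    rw [← IsStochasticPair.expTwist_zero, h.vecMul_expTwist_zero] at h1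
    have h2 : (1 - c) * (complexVec p ⬝ᵥ y) = 0 := by linear_combination h1
    exact (mul_eq_zero.mp h2).resolve_left (sub_ne_zero.mpr hc.symm)
  have hNy : N *ᵥ y = c • y := by
    have h1 : N = (A + B).map Complex.ofReal - Matrix.vecMulVec 1 (complexVec p) := by
      ext i j
      simp [hN, complexVec]
    rw [h1, Matrix.sub_mulVec, hy, Matrix.vecMulVec_mulVec, hpy]
    simp
  have hNn : ∀ n : ℕ, (N ^ n) *ᵥ y = c ^ n • y := fun n => by
    induction n with
    | zero => simp
    | succ n ih =>
      rw [pow_succ, ← Matrix.mulVec_mulVec, hNy, Matrix.mulVec_smul, ih, smul_smul, pow_succ']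
  have hNK : ‖N ^ K‖ < 1 := by
    rw [hN, ← Matrix.map_pow]
    exact (Matrix.linfty_opNorm_map_ofReal _).trans_lt hlt
  have h1 := Matrix.linfty_opNorm_mulVec (N ^ K) y
  rw [hNn, norm_smul, norm_pow] at h1
  have h2 : 0 < ‖y‖ := norm_pos_iff.mpr hy0
  have h3 : ‖c‖ ^ K < 1 := (le_of_mul_le_mul_right h1 h2).trans_lt hNK
  exact (pow_lt_one_iff_of_nonneg (norm_nonneg c) hK.ne').mp h3

/-! ### Perron eigenvalues and the reduction to the stochastic case. -/

theorem IsPerronEigenvalue.unique {m : ℕ} {M : Matrix (Fin m) (Fin m) ℝ} {l l' : ℝ}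
    (h : IsPerronEigenvalue M l) (h' : IsPerronEigenvalue M l') : l = l' := by
  by_contra hne
  have h1 := h.2.2 l' h'.2.1 (fun e => hne (Complex.ofReal_injective e).symm)
  have h2 := h'.2.2 l h.2.1 (fun e => hne (Complex.ofReal_injective e))
  rw [Complex.norm_real, Real.norm_of_nonneg h'.1.le] at h1
  rw [Complex.norm_real, Real.norm_of_nonneg h.1.le] at h2
  linarith

/-- The matrix `l⁻¹ D⁻¹ M D` with `D` the diagonal matrix with diagonal `v`. -/
noncomputable def scaleConj {m : ℕ} (l : ℝ) (v : Fin m → ℝ) (M : Matrix (Fin m) (Fin m) ℝ) :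
    Matrix (Fin m) (Fin m) ℝ :=
  Matrix.of fun i j => l⁻¹ * ((v i)⁻¹ * M i j * v j)

theorem scaleConj_add {m : ℕ} (l : ℝ) (v : Fin m → ℝ) (M N : Matrix (Fin m) (Fin m) ℝ) :
    scaleConj l v M + scaleConj l v N = scaleConj l v (M + N) := by
  ext i j
  simp only [scaleConj, Matrix.add_apply, Matrix.of_apply]
  ring

theorem scaleConj_mul {m : ℕ} {v : Fin m → ℝ} (hv : ∀ i, 0 < v i) (l l' : ℝ)
    (M N : Matrix (Fin m) (Fin m) ℝ) :
    scaleConj l v M * scaleConj l' v N = scaleConj (l * l') v (M * N) := by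
  ext i j
  simp only [scaleConj, Matrix.mul_apply, Matrix.of_apply, Finset.mul_sum, Finset.sum_mul]
  refine Finset.sum_congr rfl fun k _ => ?_
  have := (hv k).ne'
  rw [mul_inv]
  field_simp

theorem scaleConj_one {m : ℕ} {v : Fin m → ℝ} (hv : ∀ i, 0 < v i) :
    scaleConj 1 v (1 : Matrix (Fin m) (Fin m) ℝ) = 1 := by
  ext i j
  have := (hv i).ne'
  by_cases hij : i = j
  · subst hij
    simp [scaleConj, this]
  · simp [scaleConj, hij]

theorem scaleConj_pow {m : ℕ} {v : Fin m → ℝ} (hv : ∀ i, 0 < v i) (l : ℝ)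
    (M : Matrix (Fin m) (Fin m) ℝ) (n : ℕ) :
    scaleConj l v M ^ n = scaleConj (l ^ n) v (M ^ n) := by
  induction n with
  | zero => simp [scaleConj_one hv]
  | succ n ih => rw [pow_succ, ih, scaleConj_mul hv, ← pow_succ, ← pow_succ]

theorem det_smul_sub_scaleConj_eq_zero_iff {m : ℕ} {v : Fin m → ℝ} (hv : ∀ i, 0 < v i) {l : ℝ}
    (hl : 0 < l) (A B : Matrix (Fin m) (Fin m) ℝ) (x c : ℂ) :
    ((x / l) • (1 : Matrix (Fin m) (Fin m) ℂ) - c • (scaleConj l v A).map Complex.ofReal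
      - (scaleConj l v B).map Complex.ofReal).det = 0 ↔
    (x • (1 : Matrix (Fin m) (Fin m) ℂ) - c • A.map Complex.ofReal
      - B.map Complex.ofReal).det = 0 := by
  have hvc : ∀ i, (v i : ℂ) ≠ 0 := fun i => Complex.ofReal_ne_zero.mpr (hv i).ne'
  have hlc : (l : ℂ) ≠ 0 := Complex.ofReal_ne_zero.mpr hl.ne'
  have h1 : (x / l) • (1 : Matrix (Fin m) (Fin m) ℂ) - c • (scaleConj l v A).map Complex.ofReal
      - (scaleConj l v B).map Complex.ofReal =
      Matrix.diagonal (fun i => ((l : ℂ) * v i)⁻¹) *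
        (x • (1 : Matrix (Fin m) (Fin m) ℂ) - c • A.map Complex.ofReal - B.map Complex.ofReal) *
        Matrix.diagonal fun i => (v i : ℂ) := by
    ext i j
    have := hvc i
    rw [Matrix.mul_diagonal, Matrix.diagonal_mul]
    by_cases hij : i = j
    · subst hij
      simp [scaleConj]
      field_simp
    · simp [scaleConj, hij]
      ring
  rw [h1, Matrix.det_mul, Matrix.det_mul, Matrix.det_diagonal, Matrix.det_diagonal,
    mul_eq_zero, mul_eq_zero]
  have h2 : ∏ i, ((l : ℂ) * v i)⁻¹ ≠ 0 :=
    Finset.prod_ne_zero_iff.mpr fun i _ => inv_ne_zero (mul_ne_zero hlc (hvc i))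
  have h3 : ∏ i, (v i : ℂ) ≠ 0 := Finset.prod_ne_zero_iff.mpr fun i _ => hvc i
  simp only [h2, h3, false_or, or_false]

theorem isEigenvalueBranch_scaleConj_iff {m : ℕ} {v : Fin m → ℝ} (hv : ∀ i, 0 < v i) {l : ℝ}
    (hl : 0 < l) (A B : Matrix (Fin m) (Fin m) ℝ) (u : ℂ → ℂ) :
    IsEigenvalueBranch (scaleConj l v A) (scaleConj l v B) 1 (fun z => u z / l) ↔
      IsEigenvalueBranch A B l u := by
  have hlc : (l : ℂ) ≠ 0 := Complex.ofReal_ne_zero.mpr hl.ne'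
  simp only [IsEigenvalueBranch, det_smul_sub_scaleConj_eq_zero_iff hv hl, Complex.ofReal_one,
    div_eq_one_iff_eq hlc]
  refine and_congr_left' ⟨fun h => ?_, fun h => h.div_const⟩
  have h1 := h.mul (analyticAt_const (v := (l : ℂ)))
  refine h1.congr (Filter.Eventually.of_forall fun z => ?_)
  exact div_mul_cancel₀ _ hlc

namespace LinearRep

variable {m : ℕ} (R : LinearRep m)

/-- The representation obtained by conjugating with the diagonal matrix of `v` and dividing by
`l`. -/
noncomputable def rescale {l : ℝ} (hl : 0 < l) {v : Fin m → ℝ} (hv : ∀ i, 0 < v i) :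
    LinearRep m where
  ξ i := R.ξ i * v i
  A := scaleConj l v R.A
  B := scaleConj l v R.B
  η i := (v i)⁻¹ * R.η i
  ξ_nonneg i := mul_nonneg (R.ξ_nonneg i) (hv i).le
  A_nonneg i j := mul_nonneg (inv_nonneg.mpr hl.le)
    (mul_nonneg (mul_nonneg (inv_nonneg.mpr (hv i).le) (R.A_nonneg i j)) (hv j).le)
  B_nonneg i j := mul_nonneg (inv_nonneg.mpr hl.le)
    (mul_nonneg (mul_nonneg (inv_nonneg.mpr (hv i).le) (R.B_nonneg i j)) (hv j).le)
  η_nonneg i := mul_nonneg (inv_nonneg.mpr (hv i).le) (R.η_nonneg i)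

variable {l : ℝ} (hl : 0 < l) {v : Fin m → ℝ} (hv : ∀ i, 0 < v i)

theorem rescale_letterMatrix (x : Letter) :
    (R.rescale hl hv).letterMatrix x = scaleConj l v (R.letterMatrix x) := by
  cases x <;> rfl

theorem rescale_μ (w : List Letter) :
    (R.rescale hl hv).μ (FreeMonoid.ofList w) =
      scaleConj (l ^ w.length) v (R.μ (FreeMonoid.ofList w)) := by
  induction w with
  | nil => simp [scaleConj_one hv]
  | cons x w ih =>
    rw [μ_cons, μ_cons, ih, rescale_letterMatrix, scaleConj_mul hv, List.length_cons, pow_succ']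

/-- The diagonal factors cancel against those placed in ξ and η. The scalar left over depends only
on the length, so it drops out of the probabilities. -/
theorem rescale_weight {n : ℕ} (w : List.Vector Letter n) :
    (R.rescale hl hv).weight w = (l ^ n)⁻¹ * R.weight w := by
  simp only [weight, series, rescale_μ, List.Vector.toList_length, Matrix.mulVec, dotProduct,
    scaleConj, Matrix.of_apply, Finset.mul_sum]
  refine Finset.sum_congr rfl fun i _ => Finset.sum_congr rfl fun j _ => ?_
  have h1 := (hv i).ne'
  have h2 := (hv j).ne'
  simp only [rescale]
  field_simp

theorem rescale_probY (n k : ℕ) : (R.rescale hl hv).probY n k = R.probY n k := by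
  have h : (l ^ n)⁻¹ ≠ 0 := by positivity
  simp only [probY, wordProb, rescale_weight, ← Finset.mul_sum, mul_div_mul_left _ _ h]

theorem rescale_hasPositiveWords (hR : R.HasPositiveWords) :
    (R.rescale hl hv).HasPositiveWords := fun n hn => by
  obtain ⟨w, hw⟩ := hR n hn
  refine ⟨w, ?_⟩
  rw [rescale_weight]
  positivity

theorem rescale_edge : (R.rescale hl hv).Edge = R.Edge := by
  ext x i j
  have h1 := hv i
  have h2 := hv j
  rw [Edge, Edge, rescale_letterMatrix, scaleConj, Matrix.of_apply,
    mul_pos_iff_of_pos_left (by positivity), mul_pos_iff_of_pos_right h2,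
    mul_pos_iff_of_pos_left (by positivity)]

theorem rescale_walk (i : Fin m) (w : List Letter) (j : Fin m) :
    (R.rescale hl hv).Walk i w j ↔ R.Walk i w j := by
  induction w generalizing i with
  | nil => exact Iff.rfl
  | cons x w ih => simp only [Walk, rescale_edge, ih]

theorem rescale_isAperiodic (hd : R.IsAperiodic) : (R.rescale hl hv).IsAperiodic := by
  have h : (R.rescale hl hv).cycleDiffs = R.cycleDiffs := by
    simp only [cycleDiffs, IsCycleLabel, rescale_walk]
  rw [IsAperiodic, h]
  exact hd

/-- Doob's transform: the right eigenvector v normalises the row sums to 1, and its entrywise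
product with the left eigenvector is stationary. -/
theorem rescale_isStochasticPair (hM : (R.A + R.B).IsPrimitive)
    (hMv : (R.A + R.B) *ᵥ v = l • v) {w : Fin m → ℝ} (hw : ∀ i, 0 < w i)
    (hwM : w ᵥ* (R.A + R.B) = l • w) (hwv : w ⬝ᵥ v = 1) :
    IsStochasticPair (R.rescale hl hv).A (R.rescale hl hv).B (fun i => w i * v i) := by
  have hadd : (R.rescale hl hv).A + (R.rescale hl hv).B = scaleConj l v (R.A + R.B) :=
    scaleConj_add l v _ _
  have hsum : ∀ i j, 0 ≤ ((R.rescale hl hv).A + (R.rescale hl hv).B) i j := fun i j =>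
    add_nonneg ((R.rescale hl hv).A_nonneg i j) ((R.rescale hl hv).B_nonneg i j)
  refine ⟨(R.rescale hl hv).A_nonneg, (R.rescale hl hv).B_nonneg, ⟨hsum, ?_⟩, ?_, ?_,
    fun i => mul_pos (hw i) (hv i), ?_⟩
  · obtain ⟨-, k, hk, hpos⟩ := hM
    refine ⟨k, hk, fun i j => ?_⟩
    rw [hadd, scaleConj_pow hv, scaleConj, Matrix.of_apply]
    have h1 := hv i
    have h2 := hv j
    have h3 := hpos i j
    positivity
  · rw [hadd]
    ext i
    have h1 := congrFun hMv i
    have h2 := (hv i).ne'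
    simp only [Matrix.mulVec, dotProduct, Pi.smul_apply, smul_eq_mul] at h1
    simp only [Matrix.mulVec, dotProduct, scaleConj, Matrix.of_apply, Pi.one_apply, mul_one,
      mul_assoc, ← Finset.mul_sum, h1]
    field_simp
  · rw [hadd]
    ext j
    have h1 := congrFun hwM j
    simp only [Matrix.vecMul, dotProduct, Pi.smul_apply, smul_eq_mul] at h1
    have h2 : ∀ i, w i * v i * scaleConj l v (R.A + R.B) i j =
        l⁻¹ * v j * (w i * (R.A + R.B) i j) := fun i => by
      have := (hv i).ne'
      simp only [scaleConj, Matrix.of_apply]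
      field_simp
    simp only [Matrix.vecMul, dotProduct, h2, ← Finset.mul_sum, h1]
    field_simp
  · simpa [dotProduct] using hwv

/-- An eigenvector y of A + B for c becomes, after dividing by v entrywise, one of the stochastic
matrix for c / l, so the strict bound there carries over. -/
theorem isPerronEigenvalue_of_rescale {p : Fin m → ℝ}
    (h : IsStochasticPair (R.rescale hl hv).A (R.rescale hl hv).B p)
    (hMv : (R.A + R.B) *ᵥ v = l • v) : IsPerronEigenvalue (R.A + R.B) l := by
  have hlc : (l : ℂ) ≠ 0 := Complex.ofReal_ne_zero.mpr hl.ne'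
  have hvc : ∀ i, (v i : ℂ) ≠ 0 := fun i => Complex.ofReal_ne_zero.mpr (hv i).ne'
  refine ⟨hl, ?_, fun c hc hcl => ?_⟩
  · refine Module.End.hasEigenvalue_of_hasEigenvector (x := complexVec v)
      ⟨Module.End.mem_eigenspace_iff.mpr ?_, fun h0 => ?_⟩
    · rw [Matrix.toLin'_apply]
      refine (map_ofReal_mulVec_complexVec _ _).trans ?_
      rw [hMv]
      ext i
      simp [complexVec]
    · obtain ⟨i⟩ := h.nonempty
      exact hvc i (congrFun h0 i)
  · obtain ⟨y, hy, hy0⟩ := hc.exists_hasEigenvector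
    rw [Module.End.mem_eigenspace_iff, Matrix.toLin'_apply] at hy
    have hadd : (R.rescale hl hv).A + (R.rescale hl hv).B = scaleConj l v (R.A + R.B) :=
      scaleConj_add l v _ _
    have h1 : ((R.rescale hl hv).A + (R.rescale hl hv).B).map Complex.ofReal *ᵥ
        (fun i => (v i : ℂ)⁻¹ * y i) = (c / l) • fun i => (v i : ℂ)⁻¹ * y i := by
      rw [hadd]
      ext i
      have h2 := congrFun hy i
      simp only [Matrix.mulVec, dotProduct, Matrix.map_apply, Pi.smul_apply, smul_eq_mul] at h2
      have h3 : ∀ j, ((scaleConj l v (R.A + R.B) i j : ℝ) : ℂ) * ((v j : ℂ)⁻¹ * y j) =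
          (l : ℂ)⁻¹ * (v i : ℂ)⁻¹ * (((R.A + R.B) i j : ℝ) * y j) := fun j => by
        have := hvc j
        simp only [scaleConj, Matrix.of_apply, Complex.ofReal_mul, Complex.ofReal_inv]
        field_simp
      simp only [Matrix.mulVec, dotProduct, Matrix.map_apply, h3, ← Finset.mul_sum,
        Pi.smul_apply, smul_eq_mul]
      rw [h2]
      field_simp
    have h4 : (fun i => (v i : ℂ)⁻¹ * y i) ≠ 0 := by
      obtain ⟨i, hi⟩ := Function.ne_iff.mp hy0
      exact Function.ne_iff.mpr ⟨i, mul_ne_zero (inv_ne_zero (hvc i)) hi⟩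
    have h5 := h.norm_lt_one_of_eigenvector h1 h4 (by rwa [ne_eq, div_eq_one_iff_eq hlc])
    rwa [norm_div, Complex.norm_real, Real.norm_of_nonneg hl.le, div_lt_one hl] at h5

end LinearRep

/-! ### The theorem for general A and B. -/

theorem deriv_div_const_eq_betaOf (l : ℝ) (u : ℂ → ℂ) :
    deriv (fun z => u z / l) 0 = betaOf l u := by
  rw [deriv_div_const, betaOf]

theorem iteratedDeriv_div_const_eq_gammaOf (l : ℝ) (u : ℂ → ℂ) :
    iteratedDeriv 2 (fun z => u z / l) 0 - deriv (fun z => u z / l) 0 ^ 2 = gammaOf l u := by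
  have h : deriv (fun z => u z / l) = fun z => deriv u z / l := by
    ext z
    rw [deriv_div_const]
  rw [iteratedDeriv_succ, iteratedDeriv_one, h, deriv_div_const, gammaOf, iteratedDeriv_succ,
    iteratedDeriv_one]

theorem mainTheorem1 {m : ℕ} (R : LinearRep m)
    (hR : R.HasPositiveWords)
    (hM : (R.A + R.B).IsPrimitive)
    (hA : R.A ≠ 0) (hB : R.B ≠ 0)
    (hd : R.IsAperiodic) :
    (∃ (l : ℝ) (u : ℂ → ℂ),
      IsPerronEigenvalue (R.A + R.B) l ∧ IsEigenvalueBranch R.A R.B l u) ∧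
    ∀ (l : ℝ) (u : ℂ → ℂ),
      IsPerronEigenvalue (R.A + R.B) l → IsEigenvalueBranch R.A R.B l u →
      ∃ β γ : ℝ, (β : ℂ) = betaOf l u ∧ (γ : ℂ) = gammaOf l u ∧ 0 < β ∧ 0 < γ ∧
        ∃ (C : ℝ) (N : ℕ), ∀ n : ℕ, N ≤ n → ∀ k : ℕ, k ≤ n →
          |√(n : ℝ) * R.probY n k -
              Real.exp (-((k : ℝ) - β * n) ^ 2 / (2 * γ * n)) / √(2 * Real.pi * γ)|
            ≤ C * (n : ℝ) ^ (-(1 / 2) : ℝ) := by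
  have hne : Nonempty (Fin m) := by
    obtain ⟨i, -⟩ := Function.ne_iff.mp hA
    exact ⟨i⟩
  obtain ⟨l, hl, v, w, hv, hw, hMv, hwM, hwv⟩ := hM.exists_perron_pair
  have h := R.rescale_isStochasticPair hl hv hM hMv hw hwM hwv
  have hperron := R.isPerronEigenvalue_of_rescale hl hv h hMv
  have hd' := R.rescale_isAperiodic hl hv hd
  refine ⟨?_, fun l' u hl' hu => ?_⟩
  · obtain ⟨u, hu⟩ := h.exists_branch
    refine ⟨l, fun z => u z * l, hperron, ?_⟩
    rw [← isEigenvalueBranch_scaleConj_iff hv hl]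
    have hul : (fun z => u z * l / l) = u :=
      funext fun z => mul_div_cancel_right₀ _ (Complex.ofReal_ne_zero.mpr hl.ne')
    rw [hul]
    exact hu
  -- Strict dominance determines l, so an arbitrary admissible l is the eigenvalue used for
  -- rescaling.
  · obtain rfl := hl'.unique hperron
    have hu' : IsEigenvalueBranch (R.rescale hl hv).A (R.rescale hl hv).B 1 (fun z => u z / l') :=
      (isEigenvalueBranch_scaleConj_iff hv hl _ _ _).mpr hu
    have hA' : (R.rescale hl hv).A ≠ 0 := fun h0 => hA <| by
      ext i j
      have h1 := congrFun (congrFun h0 i) j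
      simpa [LinearRep.rescale, scaleConj, hl.ne', (hv i).ne', (hv j).ne'] using h1
    obtain ⟨β, γ, hβ, hγ, hβ0, hγ0⟩ := h.branch_mean_variance_pos hu' hA'
      ((R.rescale hl hv).not_exists_potential hd')
    obtain ⟨C, hC⟩ := (R.rescale hl hv).local_limit_of_isStochasticPair
      (R.rescale_hasPositiveWords hl hv hR) h hd' hu' hβ hγ hγ0
    rw [deriv_div_const_eq_betaOf] at hβ
    rw [iteratedDeriv_div_const_eq_gammaOf] at hγ
    refine ⟨β, γ, hβ, hγ, hβ0, hγ0, C, 1, fun n hn k _ => ?_⟩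
    simpa only [LinearRep.rescale_probY] using hC n hn k
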